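/- Let $\Omega\subset\mathbb R^2$ be a polygon, i.e. the bounded open connected region enclosed by a simple closed polygonal line, and let $H^1(\Omega)$ be the real Sobolev space. For $p>2$, $\lambda\in\mathbb R$, $\mu>0$ and $u\in H^1(\Omega)$ put $$E_p(u)=\tfrac12\|\nabla u\|_{L^2(\Omega)}^2-\tfrac1p\|u\|_{L^p(\Omega)}^p,\qquad J_p(u,\lambda)=E_p(u)+\tfrac\lambda2\|u\|_{L^2(\Omega)}^2,$$ $$H^1_\mu(\Omega)=\{u\in H^1(\Omega):\|u\|_{L^2(\Omega)}^2=\mu\},\qquad \mathcal N_p(\lambda)=\{u\in H^1(\Omega)\setminus\{0\}:\|\nabla u\|_{L^2(\Omega)}^2+\lambda\|u\|_{L^2(\Omega)}^2=\|u\|_{L^p(\Omega)}^p\}.$$ An action ground state at frequency $\lambda$ is a $u\in\mathcal N_p(\lambda)$ with $J_p(u,\lambda)=\inf_{v\in\mathcal N_p(\lambda)}J_p(v,\lambda)$; let $M_p^-(\lambda)$ and $M_p^+(\lambda)$ be the infimum and the supremum of $\|u\|_{L^2(\Omega)}^2$ over all action ground states $u$ at frequency $\lambda$. An energy ground state with mass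 $\mu$ is a $u\in H^1_\mu(\Omega)$ with $E_p(u)=\inf_{v\in H^1_\mu(\Omega)}E_p(v)$; let $\Lambda_p^-(\mu)$ and $\Lambda_p^+(\mu)$ be the infimum and the supremum of $$\lambda_u=\frac{\|u\|_{L^p(\Omega)}^p-\|\nabla u\|_{L^2(\Omega)}^2}{\|u\|_{L^2(\Omega)}^2}$$ over all energy ground states $u$ with mass $\mu$, and, for $p\in(2,4)$, let $W_p=\{\mu>0:\Lambda_p^-(\mu)\neq\Lambda_p^+(\mu)\}$. Proposition. Suppose that there are $0<\lambda_1<\lambda_2$ with $M_4^-(\lambda_1)>M_4^+(\lambda_2)$. Then there is $\varepsilon>0$ such that $W_p\neq\emptyset$ for every $p\in(4-\varepsilon,4)$. -/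

import Mathlib

open MeasureTheory Set
open scoped ContDiff

noncomputable section

namespace NLSPolygon

/-- The Euclidean plane. -/
abbrev Plane : Type := EuclideanSpace ℝ (Fin 2)

/-- The closed polygonal line through the vertices of `P` is a simple closed curve:
consecutive vertices are distinct, and the edges, each taken with its initial but without its
final vertex, are pairwise disjoint. -/
def IsSimplePolygon {n : ℕ} (P : Polygon Plane n) : Prop :=
  3 ≤ n ∧ P.HasNondegenerateEdges ∧
    Pairwise fun i j => Disjoint (P.edgePath ℝ i '' Ico (0 : ℝ) 1) (P.edgePath ℝ j '' Ico (0 : ℝ) 1)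

/-- `Ω` is the (open) region enclosed by a simple closed polygonal line: a bounded, open,
connected, nonempty set whose topological boundary is that line. -/
def IsPolygonalDomain (Ω : Set Plane) : Prop :=
  IsOpen Ω ∧ IsConnected Ω ∧ Bornology.IsBounded Ω ∧
    ∃ (n : ℕ) (P : Polygon Plane n), IsSimplePolygon P ∧ frontier Ω = P.boundary ℝ

/-- `G` is the weak gradient of `u` in `Ω`: for all `φ ∈ C_c^∞(Ω)` and all directions `w`,
`∫_Ω u ∂_w φ = - ∫_Ω (G · w) φ`. -/
def IsWeakGradient (Ω : Set Plane) (u : Plane → ℝ) (G : Plane → Plane) : Prop :=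
  ∀ φ : Plane → ℝ, ContDiff ℝ ∞ φ → HasCompactSupport φ → tsupport φ ⊆ Ω →
    ∀ w : Plane,
      ∫ x in Ω, u x * fderiv ℝ φ x w = -∫ x in Ω, inner ℝ (G x) w * φ x

/-- The real Sobolev space `H¹(Ω)`: an element is a class `toLp ∈ L²(Ω)` together with its weak
gradient `grad ∈ L²(Ω; ℝ²)` (which is determined by `toLp` when `Ω` is open). -/
@[ext]
structure H1 (Ω : Set Plane) where
  /-- the function, as an element of `L²(Ω)` -/
  toLp : Lp ℝ 2 (volume.restrict Ω)
  /-- its weak gradient, as an element of `L²(Ω; ℝ²)` -/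
  grad : Lp Plane 2 (volume.restrict Ω)
  isWeakGradient : IsWeakGradient Ω toLp grad

variable {Ω : Set Plane}

/-- The mass `‖u‖²_{L²(Ω)}`. -/
def mass (u : H1 Ω) : ℝ := ‖u.toLp‖ ^ 2

/-- `‖∇u‖²_{L²(Ω)}`. -/
def gradSq (u : H1 Ω) : ℝ := ‖u.grad‖ ^ 2

/-- `‖u‖^p_{L^p(Ω)}`, for a real exponent `p`. -/
def lpPow (p : ℝ) (u : H1 Ω) : ℝ := ∫ x in Ω, |u.toLp x| ^ p

/-- The energy `E_p(u, Ω) = ½ ‖∇u‖₂² - (1/p) ‖u‖_p^p`. -/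
def energy (p : ℝ) (u : H1 Ω) : ℝ := 1 / 2 * gradSq u - 1 / p * lpPow p u

/-- The action `J_p(u, lam, Ω) = ½ ‖∇u‖₂² + (lam/2) ‖u‖₂² - (1/p) ‖u‖_p^p`. -/
def action (p lam : ℝ) (u : H1 Ω) : ℝ :=
  1 / 2 * gradSq u + lam / 2 * mass u - 1 / p * lpPow p u

/-- The constraint set `H¹_μ(Ω)` of functions of mass `μ`. -/
def massSphere (Ω : Set Plane) (μ : ℝ) : Set (H1 Ω) := {u | mass u = μ}

/-- The Nehari manifold `N_p(lam, Ω)`. -/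
def nehari (Ω : Set Plane) (p lam : ℝ) : Set (H1 Ω) :=
  {u | u.toLp ≠ 0 ∧ gradSq u + lam * mass u = lpPow p u}

/-- The energy level `inf_{H¹_μ(Ω)} E_p`, possibly infinite. -/
def energyLevel (Ω : Set Plane) (p μ : ℝ) : EReal :=
  ⨅ v ∈ massSphere Ω μ, ((energy p v : ℝ) : EReal)

/-- The action level `inf_{N_p(lam, Ω)} J_p(·, lam, Ω)`, possibly infinite. -/
def actionLevel (Ω : Set Plane) (p lam : ℝ) : EReal :=
  ⨅ v ∈ nehari Ω p lam, ((action p lam v : ℝ) : EReal)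

/-- The energy ground states with mass `μ`. -/
def energyGroundStates (Ω : Set Plane) (p μ : ℝ) : Set (H1 Ω) :=
  {u | u ∈ massSphere Ω μ ∧ ((energy p u : ℝ) : EReal) = energyLevel Ω p μ}

/-- The action ground states at frequency `lam`. -/
def actionGroundStates (Ω : Set Plane) (p lam : ℝ) : Set (H1 Ω) :=
  {u | u ∈ nehari Ω p lam ∧ ((action p lam u : ℝ) : EReal) = actionLevel Ω p lam}

/-- `M_p^-(lam)`: the least mass of an action ground state at frequency `lam`. -/
def massInf (Ω : Set Plane) (p lam : ℝ) : ℝ := sInf (mass '' actionGroundStates Ω p lam)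

/-- `M_p^+(lam)`: the largest mass of an action ground state at frequency `lam`. -/
def massSup (Ω : Set Plane) (p lam : ℝ) : ℝ := sSup (mass '' actionGroundStates Ω p lam)

/-- The Lagrange multiplier `λ_u = (‖u‖_p^p - ‖∇u‖₂²) / ‖u‖₂²`. -/
def multiplier (p : ℝ) (u : H1 Ω) : ℝ := (lpPow p u - gradSq u) / mass u

/-- `Λ_p^-(μ)`: the infimum of the multipliers of the energy ground states with mass `μ`. -/
def multiplierInf (Ω : Set Plane) (p μ : ℝ) : ℝ :=
  sInf (multiplier p '' energyGroundStates Ω p μ)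

/-- `Λ_p^+(μ)`: the supremum of the multipliers of the energy ground states with mass `μ`. -/
def multiplierSup (Ω : Set Plane) (p μ : ℝ) : ℝ :=
  sSup (multiplier p '' energyGroundStates Ω p μ)

/-- `W_p`: the set of masses `μ > 0` with `Λ_p^-(μ) ≠ Λ_p^+(μ)`. -/
def nonuniqueMasses (Ω : Set Plane) (p : ℝ) : Set ℝ :=
  {μ | 0 < μ ∧ multiplierInf Ω p μ ≠ multiplierSup Ω p μ}

end NLSPolygon

end

/-! The argument is by contradiction along a sequence `p → 4⁻` with `W_p` empty. Fix such a `p`. All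
energy ground states of mass `μ` then share one multiplier `Λ(μ)`, and compactness of ground states
makes `Λ` continuous on `(0, ∞)`. It tends to `0` with the mass, and comparison with constant
functions gives `Λ(c²|Ω|) ≥ (2/p) c^(p-2)`, so it also exceeds any given value. By the intermediate
value theorem `Λ` takes the values `λ₁ < λ₂` at some masses `α < β`. An energy ground state is an
action ground state at the frequency given by its multiplier
(`mem_actionGroundStates_of_mem_energyGroundStates`). Hence some action ground states at `λ₁` and
`λ₂` have masses `α < β` (`exists_mass_lt_mass`).

At a fixed positive frequency, action ground states for `p → 4⁻` converge along a subsequence, with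
their masses, to an action ground state for `p = 4` (`exists_actionGroundState_limit`). The limits
`a` at `λ₁` and `b` at `λ₂` satisfy `mass a ≤ mass b`, which contradicts `M_4^-(λ₁) > M_4^+(λ₂)`.

Two facts about `H¹(Ω)` support this: the inequality `‖u‖₄⁴ ≤ A ‖u‖₂² (‖u‖₂² + ‖∇u‖₂²)` and
Rellich's theorem. Both are proved without an extension operator. Up to a null set, a polygon is a
finite union of open convex cells. On a cell, `u` is compared with its averages against a bump
contracted towards `x` by a factor `σ`. The error is controlled by `∇u` convolved with `1/|y|` cut
off at distance of order `σ`, and Young's inequality `L^{4/3} * L² ⊆ L⁴` turns this into powers of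
`σ`. Optimizing `σ` gives the inequality; sending `σ → 0` gives compactness. -/

noncomputable section

namespace NLSPolygon

open Filter Topology
open scoped ENNReal

variable {Ω : Set Plane}

/-! ### Decomposition of a polygon into convex cells -/

/-- A preconnected set which meets an open set but not its frontier is contained in it. -/
theorem _root_.IsPreconnected.subset_of_disjoint_frontier {X : Type*} [TopologicalSpace X]
    {s t : Set X} (hs : IsPreconnected s) (ht : IsOpen t) (hst : (s ∩ t).Nonempty)
    (hd : Disjoint s (frontier t)) : s ⊆ t := by
  refine hs.subset_left_of_subset_union (v := (closure t)ᶜ) ht isClosed_closure.isOpen_compl ?_ ?_ hst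
  · exact disjoint_left.2 fun x hx hx' => hx' (subset_closure hx)
  · intro x hx
    by_cases h : x ∈ t
    · exact Or.inl h
    · right
      intro hc
      exact disjoint_left.1 hd hx ⟨hc, by rwa [ht.interior_eq]⟩

/-- A hyperplane is a null set. -/
theorem volume_hyperplane (ℓ : Plane →L[ℝ] ℝ) (hℓ : ℓ ≠ 0) (c : ℝ) :
    volume {x : Plane | ℓ x = c} = 0 := by
  rcases eq_empty_or_nonempty {x : Plane | ℓ x = c} with h | ⟨x₀, hx₀⟩
  · simp [h]
  · have : {x : Plane | ℓ x = c} = (fun x => x + -x₀) ⁻¹' (LinearMap.ker ℓ.toLinearMap : Set Plane) := by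
      ext x
      have : ℓ x₀ = c := hx₀
      simp [← this, ← sub_eq_add_neg, sub_eq_zero]
    rw [this, measure_preimage_add_right]
    apply Measure.addHaar_submodule
    intro h
    apply hℓ
    ext1 x
    have : x ∈ LinearMap.ker ℓ.toLinearMap := h ▸ Submodule.mem_top
    simpa using this

/-- The segment between two points of the plane lies on a line `{ℓ = c}`. -/
theorem exists_line_of_segment (a b : Plane) :
    ∃ (ℓ : Plane →L[ℝ] ℝ) (c : ℝ), ℓ ≠ 0 ∧ ∀ x ∈ affineSegment ℝ a b, ℓ x = c := by
  obtain ⟨d, hd, hdn⟩ : ∃ d : Plane, d ≠ 0 ∧ ∃ t : ℝ, b - a = t • d := by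
    by_cases h : b - a = 0
    · exact ⟨EuclideanSpace.single 0 1, by simp, 0, by simp [h]⟩
    · exact ⟨b - a, h, 1, by simp⟩
  obtain ⟨t, ht⟩ := hdn
  let N : Plane := !₂[-d 1, d 0]
  refine ⟨innerSL ℝ N, inner ℝ N a, ?_, ?_⟩
  · intro h
    have h1 : inner ℝ N N = 0 := by
      have := congrArg (fun f => f N) h
      simpa using this
    have h2 : N = 0 := inner_self_eq_zero.1 h1
    apply hd
    ext i
    fin_cases i
    · simpa [N] using congrArg (fun v : Plane => v 1) h2
    · simpa [N] using congrArg (fun v : Plane => v 0) h2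
  · rintro x ⟨s, -, rfl⟩
    have hNd : inner ℝ N d = 0 := by
      simp [N, PiLp.inner_apply, Fin.sum_univ_two]; ring
    rw [AffineMap.lineMap_apply, vsub_eq_sub, ht, vadd_eq_add]
    simp [inner_add_right, inner_smul_right, hNd]

/-- A polygonal domain is, up to a null set, a finite union of open convex sets. -/
theorem IsPolygonalDomain.exists_convex_cover (hΩ : IsPolygonalDomain Ω) :
    ∃ (ι : Type) (_ : Fintype ι) (K : ι → Set Plane),
      (∀ i, IsOpen (K i) ∧ Convex ℝ (K i) ∧ (K i).Nonempty ∧ K i ⊆ Ω) ∧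
        volume (Ω \ ⋃ i, K i) = 0 := by
  classical
  obtain ⟨ho, -, -, n, P, -, hfr⟩ := hΩ
  choose ℓ c hℓ hc using fun i : Fin n => exists_line_of_segment (P i) (P (finRotate n i))
  -- The lines through the edges cut the plane into open convex cells indexed by sign vectors. No
  -- cell meets the frontier, so a cell that meets `Ω` lies in `Ω`; what is left out lies on
  -- finitely many lines.
  let C : (Fin n → Bool) → Set Plane := fun s =>
    ⋂ i, if s i then {x | c i < ℓ i x} else {x | ℓ i x < c i}
  have hCo : ∀ s, IsOpen (C s) := fun s => isOpen_iInter_of_finite fun i => by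
    split_ifs
    · exact isOpen_lt continuous_const (ℓ i).continuous
    · exact isOpen_lt (ℓ i).continuous continuous_const
  have hCc : ∀ s, Convex ℝ (C s) := fun s => convex_iInter fun i => by
    split_ifs
    · exact convex_halfSpace_gt (ℓ i).isLinear (c i)
    · exact convex_halfSpace_lt (ℓ i).isLinear (c i)
  have hCd : ∀ s, Disjoint (C s) (frontier Ω) := by
    intro s
    rw [hfr, disjoint_left]
    intro x hx hxb
    obtain ⟨i, hi⟩ := mem_iUnion.1 hxb
    have h1 := hc i x hi
    have h2 := mem_iInter.1 hx i
    split_ifs at h2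
    · exact absurd h1 (ne_of_gt h2)
    · exact absurd h1 (ne_of_lt h2)
  refine ⟨{s // C s ⊆ Ω ∧ (C s).Nonempty}, inferInstance, fun s => C s.1,
    fun s => ⟨hCo _, hCc _, s.2.2, s.2.1⟩, ?_⟩
  refine measure_mono_null (t := ⋃ i, {x | ℓ i x = c i}) ?_
    (measure_iUnion_null fun i => volume_hyperplane _ (hℓ i) _)
  rintro x ⟨hx, hxn⟩
  by_contra hxl
  simp only [mem_iUnion, mem_ofPred_eq, not_exists] at hxl
  apply hxn
  have hxC : x ∈ C (fun i => decide (c i < ℓ i x)) := by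
    refine mem_iInter.2 fun i => ?_
    by_cases h : c i < ℓ i x
    · simp [h]
    · simpa [h] using lt_of_le_of_ne (not_lt.1 h) (hxl i)
  exact mem_iUnion.2 ⟨⟨_, (hCc _).isPreconnected.subset_of_disjoint_frontier ho ⟨x, hxC, hx⟩ (hCd _),
    ⟨x, hxC⟩⟩, hxC⟩

/-! ### Young's inequality and the truncated Riesz kernel -/

/-- The Cauchy–Schwarz inequality for the lower integral. -/
theorem sq_lintegral_mul_le {α : Type*} [MeasurableSpace α] {μ : Measure α} {f g : α → ℝ≥0∞}
    (hf : AEMeasurable f μ) (hg : AEMeasurable g μ) :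
    (∫⁻ a, f a * g a ∂μ) ^ 2 ≤ (∫⁻ a, f a ^ 2 ∂μ) * ∫⁻ a, g a ^ 2 ∂μ := by
  have h := ENNReal.lintegral_mul_le_Lp_mul_Lq μ (p := 2) (q := 2) .two_two hf hg
  calc (∫⁻ a, f a * g a ∂μ) ^ 2
      ≤ ((∫⁻ a, f a ^ (2 : ℝ) ∂μ) ^ (1 / (2 : ℝ)) * (∫⁻ a, g a ^ (2 : ℝ) ∂μ) ^ (1 / (2 : ℝ))) ^ 2 := by
        gcongr; exact h
    _ = _ := by
        rw [mul_pow, ← ENNReal.rpow_natCast, ← ENNReal.rpow_natCast, ← ENNReal.rpow_mul,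
          ← ENNReal.rpow_mul]
        norm_num

/-- Young's inequality `L^{4/3} * L² ⊆ L⁴`. -/
theorem lintegral_convolution_pow_four_le {k g : Plane → ℝ≥0∞} (hk : Measurable k) {S : Set Plane}
    (hg : AEMeasurable g (volume.restrict S)) :
    ∫⁻ x, (∫⁻ z in S, k (x - z) * g z) ^ 4 ≤
      (∫⁻ y, k y ^ (4 / 3 : ℝ)) ^ 3 * (∫⁻ z in S, g z ^ 2) ^ 2 := by
  set I := ∫⁻ y, k y ^ (4 / 3 : ℝ)
  set N := ∫⁻ z in S, g z ^ 2
  have hI : ∀ x, ∫⁻ z in S, k (x - z) ^ (4 / 3 : ℝ) ≤ I := fun x =>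
    (setLIntegral_le_lintegral _ _).trans
      (lintegral_sub_left_eq_self (fun y => k y ^ (4 / 3 : ℝ)) x).le
  have hmk : ∀ x (a : ℝ), Measurable fun z => k (x - z) ^ a := fun x a => by fun_prop
  have key : ∀ x, (∫⁻ z in S, k (x - z) * g z) ^ 4 ≤
      I ^ 2 * N * ∫⁻ z in S, k (x - z) ^ (4 / 3 : ℝ) * g z ^ 2 := by
    intro x
    -- Two applications of Cauchy–Schwarz, first to `k^(2/3) · (k^(1/3) g)` and then to `(k^(2/3) g)
    -- · g`, leave only `∫ k^(4/3) g²`, which Tonelli integrates in `x`.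
    have h1 : (∫⁻ z in S, k (x - z) * g z) ^ 2 ≤ I * ∫⁻ z in S, k (x - z) ^ (2 / 3 : ℝ) * g z ^ 2 := by
      have := sq_lintegral_mul_le (μ := volume.restrict S) (f := fun z => k (x - z) ^ (2 / 3 : ℝ))
        (g := fun z => k (x - z) ^ (1 / 3 : ℝ) * g z) (hmk x _).aemeasurable
        ((hmk x _).aemeasurable.mul hg)
      simp only [← mul_assoc, ← ENNReal.rpow_add_of_nonneg _ _ (show (0 : ℝ) ≤ 2 / 3 by norm_num)
        (show (0 : ℝ) ≤ 1 / 3 by norm_num), mul_pow, ← ENNReal.rpow_mul_natCast] at this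
      norm_num at this
      refine this.trans ?_
      gcongr
      simpa using hI x
    have h2 : (∫⁻ z in S, k (x - z) ^ (2 / 3 : ℝ) * g z ^ 2) ^ 2 ≤
        (∫⁻ z in S, k (x - z) ^ (4 / 3 : ℝ) * g z ^ 2) * N := by
      have := sq_lintegral_mul_le (μ := volume.restrict S)
        (f := fun z => k (x - z) ^ (2 / 3 : ℝ) * g z) (g := g) ((hmk x _).aemeasurable.mul hg) hg
      simp only [mul_assoc, mul_pow, ← ENNReal.rpow_mul_natCast, ← sq] at this
      norm_num at this
      exact this
    calc (∫⁻ z in S, k (x - z) * g z) ^ 4 = ((∫⁻ z in S, k (x - z) * g z) ^ 2) ^ 2 := by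
          rw [← pow_mul]
      _ ≤ (I * ∫⁻ z in S, k (x - z) ^ (2 / 3 : ℝ) * g z ^ 2) ^ 2 := by gcongr
      _ = I ^ 2 * (∫⁻ z in S, k (x - z) ^ (2 / 3 : ℝ) * g z ^ 2) ^ 2 := by rw [mul_pow]
      _ ≤ I ^ 2 * ((∫⁻ z in S, k (x - z) ^ (4 / 3 : ℝ) * g z ^ 2) * N) := by gcongr
      _ = _ := by ring
  have hmeas : AEMeasurable (Function.uncurry fun x z => k (x - z) ^ (4 / 3 : ℝ) * g z ^ 2)
      (volume.prod (volume.restrict S)) := by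
    have : AEMeasurable (fun p : Plane × Plane => g p.2) (volume.prod (volume.restrict S)) :=
      hg.comp_snd
    have h2 : Measurable (fun p : Plane × Plane => k (p.1 - p.2) ^ (4 / 3 : ℝ)) := by fun_prop
    exact h2.aemeasurable.mul (this.pow_const 2)
  calc ∫⁻ x, (∫⁻ z in S, k (x - z) * g z) ^ 4
      ≤ ∫⁻ x, I ^ 2 * N * ∫⁻ z in S, k (x - z) ^ (4 / 3 : ℝ) * g z ^ 2 := lintegral_mono key
    _ = I ^ 2 * N * ∫⁻ x, ∫⁻ z in S, k (x - z) ^ (4 / 3 : ℝ) * g z ^ 2 :=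
        lintegral_const_mul'' _ hmeas.lintegral_prod_right'
    _ = I ^ 2 * N * ∫⁻ z in S, ∫⁻ x, k (x - z) ^ (4 / 3 : ℝ) * g z ^ 2 := by
        rw [lintegral_lintegral_swap hmeas]
    _ = I ^ 2 * N * ∫⁻ z in S, I * g z ^ 2 := by
        congr 1
        refine lintegral_congr fun z => ?_
        rw [lintegral_mul_const _ (by fun_prop),
          lintegral_sub_right_eq_self (fun y => k y ^ (4 / 3 : ℝ)) z]
    _ = I ^ 2 * N * (I * N) := by rw [lintegral_const_mul'' _ (hg.pow_const 2)]
    _ = _ := by ring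

/-- The kernel `1 / |y|` truncated to the disc of radius `ρ`. -/
def rieszKernel (ρ : ℝ) : Plane → ℝ≥0∞ :=
  (Metric.closedBall 0 ρ).indicator fun y => ‖y‖ₑ⁻¹

theorem measurable_rieszKernel (ρ : ℝ) : Measurable (rieszKernel ρ) :=
  Measurable.indicator (by fun_prop) Metric.isClosed_closedBall.measurableSet

theorem rieszKernel_of_le {ρ : ℝ} {y : Plane} (h : ‖y‖ ≤ ρ) : rieszKernel ρ y = ‖y‖ₑ⁻¹ :=
  indicator_of_mem (by simpa using h) _

theorem rieszKernel_smul {ρ : ℝ} (hρ : 0 < ρ) (y : Plane) :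
    rieszKernel ρ (ρ • y) = ENNReal.ofReal ρ⁻¹ * rieszKernel 1 y := by
  by_cases h : ‖y‖ ≤ 1
  · rw [rieszKernel_of_le h, rieszKernel_of_le (by rw [norm_smul, Real.norm_of_nonneg hρ.le]; nlinarith),
      enorm_smul, ENNReal.mul_inv, Real.enorm_of_nonneg hρ.le, ENNReal.ofReal_inv_of_pos hρ]
    · left; simpa using hρ.ne'
    · left; simp
  · have h' : ¬ ‖ρ • y‖ ≤ ρ := by
      rw [norm_smul, Real.norm_of_nonneg hρ.le]; nlinarith
    simp only [rieszKernel]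
    rw [indicator_of_notMem (by simpa using h'), indicator_of_notMem (by simpa using h), mul_zero]

/-- The singularity `|y|^(-4/3)` is integrable at the origin of the plane because `4/3 < 2`. -/
theorem lintegral_rieszKernel_one_lt_top : ∫⁻ y, rieszKernel 1 y ^ (4 / 3 : ℝ) < ⊤ := by
  have hint : IntegrableOn (fun y : Plane => ‖y‖ ^ (-(4 / 3) : ℝ)) (Metric.ball 0 2) := by
    refine integrableOn_ball_of_norm_le_rpow (C := 1) (α := 4 / 3) (by simp) (by simp; norm_num) ?_ ?_
    · refine Filter.Eventually.of_forall fun y => ?_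
      rw [Real.norm_of_nonneg (by positivity), one_mul]
    · exact (measurable_norm.pow_const _).aestronglyMeasurable
  have := hint.2
  rw [HasFiniteIntegral] at this
  refine lt_of_le_of_lt ?_ this
  rw [← lintegral_indicator measurableSet_ball]
  refine lintegral_mono_ae ?_
  filter_upwards [Measure.ae_ne volume (0 : Plane)] with y hy
  by_cases h : ‖y‖ ≤ 1
  · have hy' : 0 < ‖y‖ := norm_pos_iff.2 hy
    rw [rieszKernel_of_le h, indicator_of_mem (by simp; linarith), Real.enorm_of_nonneg (by positivity),
      Real.rpow_neg hy'.le, ENNReal.ofReal_inv_of_pos (by positivity),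
      ← ENNReal.ofReal_rpow_of_pos hy', ofReal_norm, ENNReal.inv_rpow]
  · simp only [rieszKernel]
    rw [indicator_of_notMem (by simpa using h)]
    simp

/-- Scaling gives `ρ² · ρ^(-4/3) = ρ^(2/3)` for the integral, hence `ρ²` after cubing. This is the
source of every power of `σ` below. -/
theorem lintegral_rieszKernel {ρ : ℝ} (hρ : 0 < ρ) :
    (∫⁻ y, rieszKernel ρ y ^ (4 / 3 : ℝ)) ^ 3 =
      ENNReal.ofReal (ρ ^ 2) * (∫⁻ y, rieszKernel 1 y ^ (4 / 3 : ℝ)) ^ 3 := by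
  set I := ∫⁻ y, rieszKernel 1 y ^ (4 / 3 : ℝ)
  have h1 : ∫⁻ y, rieszKernel ρ (ρ • y) ^ (4 / 3 : ℝ) = ENNReal.ofReal ρ⁻¹ ^ (4 / 3 : ℝ) * I := by
    simp only [rieszKernel_smul hρ, ENNReal.mul_rpow_of_nonneg _ _ (show (0 : ℝ) ≤ 4 / 3 by norm_num)]
    rw [lintegral_const_mul _ ((measurable_rieszKernel 1).pow_const _)]
  have h2 : ∫⁻ y, rieszKernel ρ (ρ • y) ^ (4 / 3 : ℝ) =
      ENNReal.ofReal (ρ ^ 2)⁻¹ * ∫⁻ y, rieszKernel ρ y ^ (4 / 3 : ℝ) := by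
    have := lintegral_map (μ := (volume : Measure Plane))
      ((measurable_rieszKernel ρ).pow_const (4 / 3 : ℝ)) (measurable_const_smul ρ)
    rw [← this, Measure.map_addHaar_smul _ hρ.ne', lintegral_smul_measure]
    simp [abs_of_pos hρ]
  have h3 : ∫⁻ y, rieszKernel ρ y ^ (4 / 3 : ℝ) =
      ENNReal.ofReal (ρ ^ 2) * (ENNReal.ofReal ρ⁻¹ ^ (4 / 3 : ℝ) * I) := by
    rw [← h1, h2, ← mul_assoc, ← ENNReal.ofReal_mul (by positivity),
      mul_inv_cancel₀ (by positivity)]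
    simp
  rw [h3, mul_pow, mul_pow, ← mul_assoc, ← ENNReal.rpow_mul_natCast]
  congr 1
  norm_num
  rw [← ENNReal.ofReal_pow (by positivity),
    ← ENNReal.ofReal_pow (by positivity), ← ENNReal.ofReal_mul (by positivity)]
  congr 1
  field_simp

/-! ### Averages against dilated bumps -/

/-- A smooth probability density supported in a convex part `K` of a bounded open set `Ω`, with
the constants that control its dilations. -/
structure StarBump (Ω K : Set Plane) where
  isOpen : IsOpen Ω
  convex : Convex ℝ K
  subset : K ⊆ Ω
  diam : ℝ
  diam_pos : 0 < diam
  norm_sub_le : ∀ x ∈ Ω, ∀ z ∈ Ω, ‖z - x‖ ≤ diam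
  volume_lt_top : volume Ω < ⊤
  ψ : Plane → ℝ
  contDiff : ContDiff ℝ ∞ ψ
  nonneg : ∀ w, 0 ≤ ψ w
  integral_eq_one : ∫ w, ψ w = 1
  core : Set Plane
  isClosed_core : IsClosed core
  core_subset : core ⊆ K
  eq_zero : ∀ w, w ∉ core → ψ w = 0
  bound : ℝ
  bound_pos : 0 < bound
  le_bound : ∀ w, ψ w ≤ bound
  lip : ℝ
  norm_fderiv_le : ∀ w, ‖fderiv ℝ ψ w‖ ≤ lip

theorem exists_starBump {K : Set Plane} (hΩ : IsOpen Ω) (hb : Bornology.IsBounded Ω)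
    (hK : IsOpen K) (hKc : Convex ℝ K) (hne : K.Nonempty) (hKΩ : K ⊆ Ω) :
    Nonempty (StarBump Ω K) := by
  obtain ⟨c, hc⟩ := hne
  obtain ⟨r, hr, hrK⟩ := Metric.nhds_basis_closedBall.mem_iff.1 (hK.mem_nhds hc)
  let β : ContDiffBump c := ⟨r / 2, r, by positivity, by linarith⟩
  obtain ⟨M, hM⟩ := (β.hasCompactSupport_normed (μ := volume)).exists_bound_of_continuous
    β.continuous_normed
  have hcd : ContDiff ℝ ∞ (β.normed volume) := β.contDiff_normed
  obtain ⟨L, hL⟩ := ((β.hasCompactSupport_normed (μ := volume)).fderiv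
    (𝕜 := ℝ)).exists_bound_of_continuous (hcd.continuous_fderiv (by simp))
  obtain ⟨D, hD⟩ := Metric.isBounded_iff.1 hb
  refine ⟨{
    isOpen := hΩ
    convex := hKc
    subset := hKΩ
    diam := max D 1
    diam_pos := by positivity
    norm_sub_le := fun x hx z hz => by
      rw [← dist_eq_norm]; exact (hD hz hx).trans (le_max_left _ _)
    volume_lt_top := hb.measure_lt_top
    ψ := β.normed volume
    contDiff := hcd
    nonneg := β.nonneg_normed
    integral_eq_one := β.integral_normed
    core := Metric.closedBall c r
    isClosed_core := Metric.isClosed_closedBall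
    core_subset := hrK
    eq_zero := fun w hw => by
      have : w ∉ tsupport (β.normed volume) := by rwa [β.tsupport_normed_eq]
      exact image_eq_zero_of_notMem_tsupport this
    bound := max M 1
    bound_pos := by positivity
    le_bound := fun w => (le_abs_self _).trans ((hM w).trans (le_max_left _ _))
    lip := L
    norm_fderiv_le := hL }⟩

namespace StarBump

variable {K : Set Plane} (b : StarBump Ω K)

/-- The point `w` such that `z = x + s (w - x)`. -/
def pull (s : ℝ) (x z : Plane) : Plane := x + s⁻¹ • (z - x)

/-- The density `ψ` transported by the dilation `w ↦ x + s (w - x)`. -/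
def kern (s : ℝ) (x z : Plane) : ℝ := s⁻¹ ^ 2 * b.ψ (pull s x z)

/-- The vector field whose divergence is `-∂ₛ kern`. -/
def field (s : ℝ) (x : Plane) (w z : Plane) : ℝ := s⁻¹ ^ 3 * b.ψ (pull s x z) * inner ℝ w (z - x)

/-- The derivative of `kern` with respect to `s`. -/
def kernDeriv (s : ℝ) (x z : Plane) : ℝ :=
  -(2 * s⁻¹ ^ 3 * b.ψ (pull s x z) + s⁻¹ ^ 4 * fderiv ℝ b.ψ (pull s x z) (z - x))

/-- The average of `u` against `kern`. -/
def avg (u : Plane → ℝ) (s : ℝ) (x : Plane) : ℝ := ∫ z in Ω, u z * b.kern s x z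

theorem pull_sub (s : ℝ) (x z : Plane) : pull s x z - x = s⁻¹ • (z - x) := by simp [pull]

include b in
-- The point `z` is the convex combination `(1 - s) x + s w` with `w = pull s x z`. This is the only
-- use of convexity in the transport argument: it keeps the dilated bump inside `Ω`.
theorem mem_of_pull_mem {s : ℝ} (hs : 0 < s) (hs1 : s ≤ 1) {x z : Plane} (hx : x ∈ K)
    (h : pull s x z ∈ K) : z ∈ K := by
  have : z = (1 - s) • x + s • pull s x z := by
    simp only [pull, smul_add, smul_smul, mul_inv_cancel₀ hs.ne']
    module
  rw [this]
  exact b.convex hx h (by linarith) hs.le (by ring)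

theorem norm_sub_le_of_ne_zero {s : ℝ} (hs : 0 < s) {x z : Plane} (hx : x ∈ K)
    (h : b.ψ (pull s x z) ≠ 0) : ‖z - x‖ ≤ b.diam * s := by
  have hw : pull s x z ∈ K := b.core_subset (by by_contra hw; exact h (b.eq_zero _ hw))
  have := b.norm_sub_le x (b.subset hx) _ (b.subset hw)
  rw [pull_sub, norm_smul, norm_inv, Real.norm_of_nonneg hs.le] at this
  rwa [inv_mul_le_iff₀ hs, mul_comm] at this

theorem contDiff_pull (s : ℝ) (x : Plane) : ContDiff ℝ ∞ (pull s x) := by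
  unfold pull; fun_prop

theorem continuous_pull (s : ℝ) (x : Plane) : Continuous (pull s x) :=
  (contDiff_pull s x).continuous

theorem continuous_kern (s : ℝ) (x : Plane) : Continuous (b.kern s x) :=
  continuous_const.mul (b.contDiff.continuous.comp (continuous_pull s x))

theorem contDiff_field (s : ℝ) (x w : Plane) : ContDiff ℝ ∞ (b.field s x w) := by
  unfold field
  have := b.contDiff.comp (contDiff_pull s x)
  exact (contDiff_const.mul this).mul
    ((innerSL ℝ w).contDiff.comp (contDiff_id.sub contDiff_const))

theorem tsupport_field_subset {s : ℝ} (x w : Plane) :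
    tsupport (b.field s x w) ⊆ pull s x ⁻¹' b.core := by
  refine closure_minimal (fun z hz => ?_) (b.isClosed_core.preimage (continuous_pull s x))
  by_contra h
  exact hz (by simp [field, b.eq_zero _ h])

theorem tsupport_field_subset' {s : ℝ} (hs : 0 < s) (hs1 : s ≤ 1) {x : Plane} (hx : x ∈ K)
    (w : Plane) : tsupport (b.field s x w) ⊆ Ω := fun _ hz =>
  b.subset (b.mem_of_pull_mem hs hs1 hx (b.core_subset (b.tsupport_field_subset x w hz)))

theorem hasCompactSupport_field {s : ℝ} (hs : 0 < s) {x : Plane} (hx : x ∈ K)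
    (w : Plane) : HasCompactSupport (b.field s x w) := by
  refine HasCompactSupport.intro (isCompact_closedBall x (b.diam * s)) fun z hz => ?_
  by_contra h
  apply hz
  rw [Metric.mem_closedBall, dist_eq_norm]
  exact b.norm_sub_le_of_ne_zero hs hx fun h0 => h (by simp [field, h0])

theorem kern_nonneg (s : ℝ) (x z : Plane) : 0 ≤ b.kern s x z :=
  mul_nonneg (by positivity) (b.nonneg _)

theorem kern_le (s : ℝ) (x z : Plane) : b.kern s x z ≤ s⁻¹ ^ 2 * b.bound :=
  mul_le_mul_of_nonneg_left (b.le_bound _) (by positivity)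

theorem integral_kern {s : ℝ} (hs : 0 < s) (x : Plane) : ∫ z, b.kern s x z = 1 := by
  have h1 : ∫ z, b.ψ (pull s x z) = s ^ 2 := by
    have := integral_sub_right_eq_self (μ := (volume : Measure Plane))
      (fun y => b.ψ (x + s⁻¹ • y)) x
    simp only [pull]
    rw [this, Measure.integral_comp_inv_smul_of_nonneg volume (fun y => b.ψ (x + y)) hs.le,
      integral_add_left_eq_self (μ := (volume : Measure Plane)) b.ψ x, b.integral_eq_one]
    simp
  simp only [kern]
  rw [integral_const_mul, h1]
  field_simp

theorem kern_eq_zero {s : ℝ} (hs : 0 < s) (hs1 : s ≤ 1) {x z : Plane} (hx : x ∈ K) (hz : z ∉ Ω) :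
    b.kern s x z = 0 := by
  have : b.ψ (pull s x z) = 0 := b.eq_zero _ fun h =>
    hz (b.subset (b.mem_of_pull_mem hs hs1 hx (b.core_subset h)))
  simp [kern, this]

theorem setIntegral_kern {s : ℝ} (hs : 0 < s) (hs1 : s ≤ 1) {x : Plane} (hx : x ∈ K) :
    ∫ z in Ω, b.kern s x z = 1 := by
  rw [← b.integral_kern hs x, setIntegral_eq_integral_of_forall_compl_eq_zero]
  exact fun z hz => b.kern_eq_zero hs hs1 hx hz

theorem hasDerivAt_kern {s : ℝ} (hs : 0 < s) (x z : Plane) :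
    HasDerivAt (fun s => b.kern s x z) (b.kernDeriv s x z) s := by
  have hinv : HasDerivAt (fun s : ℝ => s⁻¹) (-(s ^ 2)⁻¹) s := hasDerivAt_inv hs.ne'
  have h1 : HasDerivAt (fun s => pull s x z) (-(s ^ 2)⁻¹ • (z - x)) s :=
    (hinv.smul_const (z - x)).const_add x
  have h2 : HasDerivAt (fun s => b.ψ (pull s x z))
      (fderiv ℝ b.ψ (pull s x z) (-(s ^ 2)⁻¹ • (z - x))) s :=
    ((b.contDiff.differentiable (by simp)).differentiableAt.hasFDerivAt).comp_hasDerivAt s h1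
  have h3 : HasDerivAt (fun s => b.kern s x z) _ s := (hinv.pow 2).mul h2
  refine h3.congr_deriv ?_
  rw [map_smul, smul_eq_mul, Pi.pow_apply, kernDeriv]
  push_cast
  field_simp
  ring

theorem fderiv_field (s : ℝ) (x w z : Plane) :
    fderiv ℝ (b.field s x w) z w = s⁻¹ ^ 4 * fderiv ℝ b.ψ (pull s x z) w * inner ℝ w (z - x) +
      s⁻¹ ^ 3 * b.ψ (pull s x z) * inner ℝ w w := by
  have h1 : HasFDerivAt (pull s x) (s⁻¹ • ContinuousLinearMap.id ℝ Plane) z :=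
    (((hasFDerivAt_id z).sub_const x).const_smul s⁻¹).const_add x
  have h2 : HasFDerivAt (fun z => b.ψ (pull s x z)) _ z :=
    ((b.contDiff.differentiable (by simp)).differentiableAt.hasFDerivAt).comp z h1
  have h3 : HasFDerivAt (fun z : Plane => inner ℝ w (z - x)) (innerSL ℝ w) z :=
    (innerSL ℝ w).hasFDerivAt.comp z ((hasFDerivAt_id z).sub_const x)
  have h4 : HasFDerivAt (b.field s x w) _ z := (h2.const_mul (s⁻¹ ^ 3)).mul h3
  rw [h4.fderiv]
  change s⁻¹ ^ 3 * b.ψ (pull s x z) * inner ℝ w w + inner ℝ w (z - x) *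
    (s⁻¹ ^ 3 * fderiv ℝ b.ψ (pull s x z) (s⁻¹ • w)) = _
  rw [map_smul, smul_eq_mul]
  ring

/-- The continuity equation: as `s` varies, `kern` is a density transported with velocity `(z - x) /
s`, and `field` is its flux. -/
theorem sum_fderiv_field (s : ℝ) (x z : Plane) :
    ∑ i, fderiv ℝ (b.field s x (EuclideanSpace.single i 1)) z (EuclideanSpace.single i 1) =
      -b.kernDeriv s x z := by
  simp only [fderiv_field, kernDeriv, neg_neg, Fin.sum_univ_two]
  have h : z - x = (z - x) 0 • EuclideanSpace.single 0 (1 : ℝ) +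
      (z - x) 1 • EuclideanSpace.single 1 (1 : ℝ) := by
    ext i; fin_cases i <;> simp
  conv_rhs => rw [h]
  simp [EuclideanSpace.inner_single_left]
  ring

end StarBump

/-! ### Pointwise control of the averages by the gradient -/

namespace StarBump

variable {K : Set Plane} (b : StarBump Ω K)

include b in
theorem isFiniteMeasure : IsFiniteMeasure (volume.restrict Ω) :=
  ⟨by simpa using b.volume_lt_top⟩

include b in
theorem integrable_toLp (u : H1 Ω) : Integrable u.toLp (volume.restrict Ω) :=
  have := b.isFiniteMeasure
  (Lp.memLp u.toLp).integrable one_le_two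

include b in
theorem integrable_grad (u : H1 Ω) : Integrable u.grad (volume.restrict Ω) :=
  have := b.isFiniteMeasure
  (Lp.memLp u.grad).integrable one_le_two

theorem norm_kernDeriv_le {s a : ℝ} (hs : 0 < s) (ha : s⁻¹ ≤ a) {x z : Plane}
    (hx : x ∈ Ω) (hz : z ∈ Ω) :
    ‖b.kernDeriv s x z‖ ≤ 2 * a ^ 3 * b.bound + a ^ 4 * (b.lip * b.diam) := by
  have hs' : 0 < s⁻¹ := inv_pos.2 hs
  have ha' : 0 < a := hs'.trans_le ha
  have h1 : ‖fderiv ℝ b.ψ (pull s x z) (z - x)‖ ≤ b.lip * b.diam :=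
    (ContinuousLinearMap.le_opNorm _ _).trans (mul_le_mul (b.norm_fderiv_le _)
      (b.norm_sub_le x hx z hz) (norm_nonneg _) ((norm_nonneg _).trans (b.norm_fderiv_le 0)))
  rw [kernDeriv, norm_neg]
  refine (norm_add_le _ _).trans (add_le_add ?_ ?_)
  · rw [Real.norm_of_nonneg (mul_nonneg (by positivity) (b.nonneg _))]
    have := b.le_bound (pull s x z)
    have := b.nonneg (pull s x z)
    gcongr
  · rw [norm_mul, Real.norm_of_nonneg (by positivity)]
    gcongr

theorem continuous_kernDeriv (s : ℝ) (x : Plane) : Continuous (b.kernDeriv s x) := by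
  have h1 := b.contDiff.continuous.comp (continuous_pull s x)
  have h2 := (b.contDiff.continuous_fderiv (by simp)).comp (continuous_pull s x)
  exact ((continuous_const.mul h1).add (continuous_const.mul
    (h2.clm_apply (continuous_id.sub continuous_const)))).neg

theorem integrable_mul_kern {u : Plane → ℝ} (hu : Integrable u (volume.restrict Ω)) (s : ℝ)
    (x : Plane) : Integrable (fun z => u z * b.kern s x z) (volume.restrict Ω) :=
  hu.mul_bdd (c := s⁻¹ ^ 2 * b.bound) (b.continuous_kern s x).aestronglyMeasurable <|
    Eventually.of_forall fun z => by
      rw [Real.norm_of_nonneg (b.kern_nonneg s x z)]; exact b.kern_le s x z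

theorem hasDerivAt_avg {u : Plane → ℝ} (hu : Integrable u (volume.restrict Ω)) {x : Plane}
    (hx : x ∈ Ω) {s : ℝ} (hs : 0 < s) :
    HasDerivAt (fun s => b.avg u s x) (∫ z in Ω, u z * b.kernDeriv s x z) s := by
  refine (hasDerivAt_integral_of_dominated_loc_of_deriv_le (s := Ioi (s / 2))
    (F := fun s z => u z * b.kern s x z) (F' := fun s z => u z * b.kernDeriv s x z)
    (bound := fun z => ‖u z‖ * (2 * (s / 2)⁻¹ ^ 3 * b.bound + (s / 2)⁻¹ ^ 4 * (b.lip * b.diam)))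
    (Ioi_mem_nhds (by linarith)) ?_ ?_ ?_ ?_ ?_ ?_).2
  · exact Eventually.of_forall fun t => (b.integrable_mul_kern hu t x).aestronglyMeasurable
  · exact b.integrable_mul_kern hu s x
  · exact hu.aestronglyMeasurable.mul (b.continuous_kernDeriv s x).aestronglyMeasurable
  · filter_upwards [ae_restrict_mem b.isOpen.measurableSet] with z hz t ht
    rw [norm_mul]
    have ht' : s / 2 < t := ht
    gcongr
    exact b.norm_kernDeriv_le (by linarith) (by gcongr) hx hz
  · exact hu.norm.mul_const _
  · refine Eventually.of_forall fun z t ht => ?_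
    have ht' : s / 2 < t := ht
    exact (b.hasDerivAt_kern (by linarith) x z).const_mul (u z)

theorem integrable_mul_of_hasCompactSupport {μ : Measure Plane} {u φ : Plane → ℝ}
    (hu : Integrable u μ) (hφ : Continuous φ) (hc : HasCompactSupport φ) :
    Integrable (fun z => u z * φ z) μ := by
  obtain ⟨C, hC⟩ := hc.exists_bound_of_continuous hφ
  exact hu.mul_bdd (c := C) hφ.aestronglyMeasurable (Eventually.of_forall hC)

/-- By the continuity equation the left side is `-∫ u div F`, where the flux `F` is smooth with
compact support in `Ω`; the weak gradient identity, applied to each coordinate of `F`, moves the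
derivative to `u`. -/
theorem integral_mul_kernDeriv (u : H1 Ω) {x : Plane} (hx : x ∈ K) {s : ℝ} (hs : 0 < s)
    (hs1 : s ≤ 1) :
    ∫ z in Ω, u.toLp z * b.kernDeriv s x z =
      ∫ z in Ω, s⁻¹ ^ 3 * b.ψ (pull s x z) * inner ℝ (u.grad z) (z - x) := by
  let e : Fin 2 → Plane := fun i => EuclideanSpace.single i 1
  have hw : ∀ i, ∫ z in Ω, u.toLp z * fderiv ℝ (b.field s x (e i)) z (e i) =
      -∫ z in Ω, inner ℝ (u.grad z) (e i) * b.field s x (e i) z := fun i =>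
    u.isWeakGradient _ (b.contDiff_field s x (e i)) (b.hasCompactSupport_field hs hx (e i))
      (b.tsupport_field_subset' hs hs1 hx (e i)) (e i)
  have hi1 : ∀ i, Integrable (fun z => u.toLp z * fderiv ℝ (b.field s x (e i)) z (e i))
      (volume.restrict Ω) := fun i => by
    refine integrable_mul_of_hasCompactSupport (b.integrable_toLp u)
      (((b.contDiff_field s x (e i)).continuous_fderiv (by simp)).clm_apply continuous_const) ?_
    exact (b.hasCompactSupport_field hs hx (e i)).fderiv_apply (𝕜 := ℝ) (e i)
  have hi2 : ∀ i, Integrable (fun z => inner ℝ (u.grad z) (e i) * b.field s x (e i) z)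
      (volume.restrict Ω) := fun i =>
    integrable_mul_of_hasCompactSupport ((b.integrable_grad u).inner_const (e i))
      (b.contDiff_field s x (e i)).continuous (b.hasCompactSupport_field hs hx (e i))
  calc ∫ z in Ω, u.toLp z * b.kernDeriv s x z
      = -∑ i, ∫ z in Ω, u.toLp z * fderiv ℝ (b.field s x (e i)) z (e i) := by
        rw [← integral_finsetSum _ fun i _ => hi1 i, ← integral_neg]
        congr 1
        ext z
        rw [← Finset.mul_sum, b.sum_fderiv_field]
        ring
    _ = ∑ i, ∫ z in Ω, inner ℝ (u.grad z) (e i) * b.field s x (e i) z := by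
        simp only [hw, Finset.sum_neg_distrib, neg_neg]
    _ = _ := by
        rw [← integral_finsetSum _ fun i _ => hi2 i]
        congr 1
        ext z
        simp [e, field, Fin.sum_univ_two, PiLp.inner_apply]
        ring

/-- The pointwise bound for the derivative of the averages in terms of the gradient. -/
def derivKernel (s : ℝ) (x z : Plane) : ℝ≥0∞ :=
  if ‖z - x‖ ≤ b.diam * s then ENNReal.ofReal (b.diam * b.bound * s⁻¹ ^ 2) else 0

theorem enorm_deriv_avg_le (u : H1 Ω) {x : Plane} (hx : x ∈ K) {s : ℝ} (hs : 0 < s)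
    (hs1 : s ≤ 1) :
    ‖deriv (fun s => b.avg u.toLp s x) s‖ₑ ≤ ∫⁻ z in Ω, b.derivKernel s x z * ‖u.grad z‖ₑ := by
  rw [(b.hasDerivAt_avg (b.integrable_toLp u) (b.subset hx) hs).deriv,
    b.integral_mul_kernDeriv u hx hs hs1]
  refine (enorm_integral_le_lintegral_enorm _).trans (lintegral_mono fun z => ?_)
  dsimp only
  by_cases h0 : b.ψ (pull s x z) = 0
  · simp [h0]
  · have hz := b.norm_sub_le_of_ne_zero hs hx h0
    rw [derivKernel, if_pos hz, ← ofReal_norm, ← ofReal_norm, ← ENNReal.ofReal_mul (by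
      have := b.diam_pos; have := b.bound_pos; positivity)]
    refine ENNReal.ofReal_le_ofReal ?_
    rw [norm_mul, Real.norm_of_nonneg (mul_nonneg (by positivity) (b.nonneg _))]
    have h1 := norm_inner_le_norm (𝕜 := ℝ) (u.grad z) (z - x)
    have h2 := b.le_bound (pull s x z)
    have h3 := b.nonneg (pull s x z)
    have h4 := b.diam_pos
    have h5 := b.bound_pos
    calc s⁻¹ ^ 3 * b.ψ (pull s x z) * ‖inner ℝ (u.grad z) (z - x)‖
        ≤ s⁻¹ ^ 3 * b.bound * (‖u.grad z‖ * (b.diam * s)) := by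
          gcongr
          exact h1.trans (by gcongr)
      _ = _ := by field_simp

/-- At a given `z` only the scales `s ≥ |z - x| / diam` contribute, and `∫ s⁻² ds` over them is
`diam / |z - x|`. Integration in scale thus produces the Riesz kernel. -/
theorem lintegral_derivKernel_le {σ : ℝ} (τ : ℝ) (hτ : 0 < τ) (x z : Plane) :
    ∫⁻ s in Ioc τ σ, b.derivKernel s x z ≤
      ENNReal.ofReal (b.diam ^ 2 * b.bound) * rieszKernel (b.diam * σ) (x - z) := by
  have hD := b.diam_pos
  have hB := b.bound_pos
  by_cases h : ‖z - x‖ ≤ b.diam * σ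
  · rw [rieszKernel_of_le (by rwa [norm_sub_rev])]
    rcases eq_or_ne x z with rfl | hne
    -- On the diagonal the Riesz kernel is `⊤`, so the bound is trivial.
    · have : ENNReal.ofReal (b.diam ^ 2 * b.bound) ≠ 0 := by
        simp; positivity
      simp [ENNReal.mul_top this]
    · set r := ‖z - x‖ with hr
      have hr0 : 0 < r := norm_pos_iff.2 (sub_ne_zero.2 hne.symm)
      calc ∫⁻ s in Ioc τ σ, b.derivKernel s x z
          ≤ ∫⁻ s, (Ici (r / b.diam)).indicator
              (fun s => ENNReal.ofReal (b.diam * b.bound * s ^ (-2 : ℝ))) s := by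
            rw [← lintegral_indicator measurableSet_Ioc]
            refine lintegral_mono fun s => ?_
            by_cases hs : s ∈ Ioc τ σ
            · rw [indicator_of_mem hs, derivKernel]
              split_ifs with h1
              · rw [indicator_of_mem (by rw [mem_Ici, div_le_iff₀ hD, mul_comm]; exact h1)]
                rw [Real.rpow_neg (hτ.trans hs.1).le]
                norm_num
              · simp
            · rw [indicator_of_notMem hs]; simp
        _ = ∫⁻ s in Ioi (r / b.diam), ENNReal.ofReal (b.diam * b.bound * s ^ (-2 : ℝ)) := by
            rw [lintegral_indicator measurableSet_Ici, setLIntegral_congr Ioi_ae_eq_Ici]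
        _ = ENNReal.ofReal (∫ s in Ioi (r / b.diam), b.diam * b.bound * s ^ (-2 : ℝ)) := by
            rw [ofReal_integral_eq_lintegral_ofReal]
            · exact (integrableOn_Ioi_rpow_of_lt (by norm_num) (by positivity)).const_mul _
            · filter_upwards [ae_restrict_mem measurableSet_Ioi] with s hs
              have : 0 < s := lt_trans (by positivity) hs
              dsimp
              positivity
        _ = ENNReal.ofReal (b.diam ^ 2 * b.bound * r⁻¹) := by
            rw [integral_const_mul, integral_Ioi_rpow_of_lt (by norm_num) (by positivity)]
            congr 1
            norm_num
            rw [Real.rpow_neg_one]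
            field_simp
        _ ≤ _ := by
            rw [ENNReal.ofReal_mul (by positivity), ENNReal.ofReal_inv_of_pos hr0, hr, ofReal_norm,
              ← enorm_neg, neg_sub]
  · have : ∫⁻ s in Ioc τ σ, b.derivKernel s x z = 0 := by
      rw [setLIntegral_eq_zero measurableSet_Ioc]
      intro s hs
      have : ¬ ‖z - x‖ ≤ b.diam * s := fun h1 => h (h1.trans (by gcongr; exact hs.2))
      simp [derivKernel, this]
    simp [this]

theorem measurable_derivKernel (x : Plane) :
    Measurable (Function.uncurry fun s z => b.derivKernel s x z) := by
  refine Measurable.ite (measurableSet_le ?_ ?_) ?_ measurable_const <;> fun_prop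

theorem measurable_derivKernel_left (x z : Plane) : Measurable fun s => b.derivKernel s x z := by
  refine Measurable.ite (measurableSet_le ?_ ?_) ?_ measurable_const <;> fun_prop

theorem enorm_avg_sub_avg_le (u : H1 Ω) {x : Plane} (hx : x ∈ K) {τ σ : ℝ} (hτ : 0 < τ)
    (hτσ : τ ≤ σ) (hσ : σ ≤ 1) :
    ‖b.avg u.toLp σ x - b.avg u.toLp τ x‖ₑ ≤ ENNReal.ofReal (b.diam ^ 2 * b.bound) *
      ∫⁻ z in Ω, rieszKernel (b.diam * σ) (x - z) * ‖u.grad z‖ₑ := by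
  have hmem : ∀ s ∈ Ioc τ σ, 0 < s ∧ s ≤ 1 := fun s hs => ⟨hτ.trans hs.1, hs.2.trans hσ⟩
  have hfin := b.isFiniteMeasure
  have hle : ∫⁻ s in Ioc τ σ, ‖deriv (fun s => b.avg u.toLp s x) s‖ₑ ≤
      ENNReal.ofReal (b.diam ^ 2 * b.bound) *
      ∫⁻ z in Ω, rieszKernel (b.diam * σ) (x - z) * ‖u.grad z‖ₑ := by
    calc ∫⁻ s in Ioc τ σ, ‖deriv (fun s => b.avg u.toLp s x) s‖ₑ
        ≤ ∫⁻ s in Ioc τ σ, ∫⁻ z in Ω, b.derivKernel s x z * ‖u.grad z‖ₑ :=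
          setLIntegral_mono' measurableSet_Ioc fun s hs =>
            b.enorm_deriv_avg_le u hx (hmem s hs).1 (hmem s hs).2
      _ = ∫⁻ z in Ω, ∫⁻ s in Ioc τ σ, b.derivKernel s x z * ‖u.grad z‖ₑ := by
          refine lintegral_lintegral_swap ?_
          have : AEMeasurable (fun p : ℝ × Plane => ‖u.grad p.2‖ₑ)
              ((volume.restrict (Ioc τ σ)).prod (volume.restrict Ω)) :=
            (Lp.aestronglyMeasurable u.grad).enorm.comp_snd
          exact (b.measurable_derivKernel x).aemeasurable.mul this
      _ ≤ ∫⁻ z in Ω, ENNReal.ofReal (b.diam ^ 2 * b.bound) *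
            (rieszKernel (b.diam * σ) (x - z) * ‖u.grad z‖ₑ) := by
          refine lintegral_mono fun z => ?_
          dsimp only
          rw [lintegral_mul_const _ (b.measurable_derivKernel_left x z), ← mul_assoc]
          exact mul_le_mul_left (b.lintegral_derivKernel_le τ hτ x z) _
      _ = _ := by rw [lintegral_const_mul' _ _ ENNReal.ofReal_ne_top]
  -- A crude bound, not uniform as `τ → 0`. It serves only to make the derivative integrable on `(τ,
  -- σ]`, as the fundamental theorem of calculus requires.
  have hbd : ∀ s ∈ Ioc τ σ, ‖deriv (fun s => b.avg u.toLp s x) s‖ₑ ≤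
      ENNReal.ofReal (b.diam * b.bound * τ⁻¹ ^ 2) * ∫⁻ z in Ω, ‖u.grad z‖ₑ := fun s hs => by
    refine (b.enorm_deriv_avg_le u hx (hmem s hs).1 (hmem s hs).2).trans ?_
    rw [← lintegral_const_mul' _ _ ENNReal.ofReal_ne_top]
    refine lintegral_mono fun z => ?_
    dsimp only [derivKernel]
    gcongr
    split_ifs
    · have := hs.1
      have := inv_pos.2 (hmem s hs).1
      have := b.diam_pos
      have := b.bound_pos
      gcongr
    · simp
  have hint : IntervalIntegrable (deriv fun s => b.avg u.toLp s x) volume τ σ := by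
    rw [intervalIntegrable_iff_integrableOn_Ioc_of_le hτσ]
    refine ⟨(stronglyMeasurable_deriv _).aestronglyMeasurable, ?_⟩
    refine (setLIntegral_mono' measurableSet_Ioc hbd).trans_lt ?_
    rw [setLIntegral_const]
    refine ENNReal.mul_lt_top (ENNReal.mul_lt_top ENNReal.ofReal_lt_top (b.integrable_grad u).2) ?_
    simp
  have hftc := intervalIntegral.integral_deriv_eq_sub (f := fun s => b.avg u.toLp s x) (a := τ)
    (b := σ) (fun s hs => ?_) hint
  · rw [← hftc, intervalIntegral.integral_of_le hτσ]
    exact (enorm_integral_le_lintegral_enorm _).trans hle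
  · rw [uIcc_of_le hτσ] at hs
    exact (b.hasDerivAt_avg (b.integrable_toLp u) (b.subset hx)
      (hτ.trans_le hs.1)).differentiableAt

end StarBump

/-! ### Estimates in `L⁴` on a convex cell -/

theorem lintegral_enorm_sq_eq {α E : Type*} [MeasurableSpace α] {μ : Measure α}
    [NormedAddCommGroup E] (f : Lp E 2 μ) : ∫⁻ x, ‖f x‖ₑ ^ 2 ∂μ = ENNReal.ofReal (‖f‖ ^ 2) := by
  rw [ENNReal.ofReal_pow (norm_nonneg _), ofReal_norm, Lp.enorm_def,
    eLpNorm_eq_lintegral_rpow_enorm_toReal (by simp) (by simp), ← ENNReal.rpow_natCast,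
    ← ENNReal.rpow_mul]
  simp

namespace StarBump

variable {K : Set Plane} (b : StarBump Ω K)

theorem kern_le_indicator {s : ℝ} (hs : 0 < s) {x : Plane} (hx : x ∈ K) (z : Plane) :
    b.kern s x z ≤ (Metric.closedBall x (b.diam * s)).indicator (fun _ => s⁻¹ ^ 2 * b.bound) z := by
  by_cases h : b.ψ (pull s x z) = 0
  · simp only [kern, h, mul_zero]
    have := b.bound_pos
    exact indicator_nonneg (fun _ _ => by positivity) _
  · rw [indicator_of_mem]
    · exact b.kern_le s x z
    · rw [Metric.mem_closedBall, dist_eq_norm]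
      exact b.norm_sub_le_of_ne_zero hs hx h

/-- Lebesgue differentiation: `kern τ x` has integral one over `Ω`, vanishes outside the ball of
radius `diam * τ` around `x`, and is bounded by a constant over the area of that ball. -/
theorem ae_tendsto_avg {u : Plane → ℝ} (hu : Integrable u (volume.restrict Ω)) :
    ∀ᵐ x, x ∈ K → Tendsto (fun τ => b.avg u τ x) (𝓝[>] 0) (𝓝 (u x)) := by
  have hΩm := b.isOpen.measurableSet
  have hfin := b.isFiniteMeasure
  have hD := b.diam_pos
  have hB := b.bound_pos
  set f := Ω.indicator u
  have hf : Integrable f := (integrable_indicator_iff hΩm).2 hu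
  filter_upwards [IsUnifLocDoublingMeasure.ae_tendsto_average_norm_sub volume
    hf.locallyIntegrable 1] with x hx hxK
  have hδ : Tendsto (fun τ : ℝ => b.diam * τ) (𝓝[>] 0) (𝓝[>] 0) := by
    refine tendsto_nhdsWithin_iff.2 ⟨?_, ?_⟩
    · have : Tendsto (fun τ : ℝ => b.diam * τ) (𝓝 0) (𝓝 (b.diam * 0)) :=
        tendsto_id.const_mul _
      rw [mul_zero] at this
      exact this.mono_left nhdsWithin_le_nhds
    · filter_upwards [self_mem_nhdsWithin] with τ hτ
      exact mul_pos hD hτ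
  have hlim := hx (fun _ => x) (fun τ => b.diam * τ) hδ (by
    filter_upwards [self_mem_nhdsWithin] with τ hτ
    have : 0 < τ := hτ
    exact Metric.mem_closedBall_self (by positivity))
  rw [tendsto_iff_norm_sub_tendsto_zero]
  set V := volume.real (Metric.ball (0 : Plane) 1)
  -- The factor is the bound `τ⁻² * bound` of the kernel times the area `(diam * τ)² V` of the ball.
  have hlim' := hlim.const_mul (b.diam ^ 2 * V * b.bound)
  rw [mul_zero] at hlim'
  refine tendsto_of_tendsto_of_tendsto_of_le_of_le' tendsto_const_nhds hlim'
    (Eventually.of_forall fun _ => norm_nonneg _) ?_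
  have h1 : ∀ᶠ τ : ℝ in 𝓝[>] 0, τ ≤ 1 :=
    mem_of_superset (Ioc_mem_nhdsGT one_pos) fun _ h => h.2
  filter_upwards [self_mem_nhdsWithin, h1] with τ hτ hτ1
  have hτ : 0 < τ := hτ
  have hfx : f x = u x := indicator_of_mem (b.subset hxK) u
  have hsplit : b.avg u τ x - u x = ∫ z in Ω, (f z - f x) * b.kern τ x z := by
    have : ∀ᵐ z ∂volume.restrict Ω, (f z - f x) * b.kern τ x z =
        u z * b.kern τ x z - u x * b.kern τ x z := by
      filter_upwards [ae_restrict_mem hΩm] with z hz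
      rw [hfx, show f z = u z from indicator_of_mem hz u]
      ring
    rw [integral_congr_ae this, integral_sub (b.integrable_mul_kern hu τ x)
      (b.integrable_mul_kern (integrable_const _) τ x), integral_const_mul,
      b.setIntegral_kern hτ hτ1 hxK, mul_one, avg]
  have hgi : Integrable ((Metric.closedBall x (b.diam * τ)).indicator
      fun z => ‖f z - f x‖ * (τ⁻¹ ^ 2 * b.bound)) := by
    rw [integrable_indicator_iff Metric.isClosed_closedBall.measurableSet]
    refine Integrable.mul_const (Integrable.norm ?_) _
    exact hf.integrableOn.sub (integrableOn_const (by
      exact (isCompact_closedBall x (b.diam * τ)).measure_lt_top.ne))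
  calc ‖b.avg u τ x - u x‖
      ≤ ∫ z in Ω, (Metric.closedBall x (b.diam * τ)).indicator
          (fun z => ‖f z - f x‖ * (τ⁻¹ ^ 2 * b.bound)) z := by
        rw [hsplit]
        refine norm_integral_le_of_norm_le hgi.restrict (Eventually.of_forall fun z => ?_)
        rw [norm_mul, Real.norm_of_nonneg (b.kern_nonneg _ _ _)]
        refine (mul_le_mul_of_nonneg_left (b.kern_le_indicator hτ hxK z) (norm_nonneg _)).trans ?_
        by_cases hz : z ∈ Metric.closedBall x (b.diam * τ) <;> simp [hz]
    _ ≤ ∫ z, (Metric.closedBall x (b.diam * τ)).indicator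
          (fun z => ‖f z - f x‖ * (τ⁻¹ ^ 2 * b.bound)) z :=
        setIntegral_le_integral hgi (Eventually.of_forall fun z =>
          indicator_nonneg (fun _ _ => by positivity) _)
    _ = _ := by
        rw [integral_indicator Metric.isClosed_closedBall.measurableSet, integral_mul_const,
          setAverage_eq, Measure.addHaar_real_closedBall _ _ (by positivity)]
        have hV : V ≠ 0 :=
          (ENNReal.toReal_pos (Metric.measure_ball_pos _ _ one_pos).ne' measure_ball_lt_top.ne).ne'
        simp only [finrank_euclideanSpace, Fintype.card_fin, smul_eq_mul]
        change _ = b.diam ^ 2 * V * b.bound * (((b.diam * τ) ^ 2 * V)⁻¹ * _)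
        field_simp

theorem ae_enorm_sub_avg_le (u : H1 Ω) :
    ∀ᵐ x ∂volume.restrict K, ∀ σ : ℝ, 0 < σ → σ ≤ 1 →
      ‖u.toLp x - b.avg u.toLp σ x‖ₑ ≤ ENNReal.ofReal (b.diam ^ 2 * b.bound) *
        ∫⁻ z in Ω, rieszKernel (b.diam * σ) (x - z) * ‖u.grad z‖ₑ := by
  rw [ae_restrict_iff'₀ (b.convex.nullMeasurableSet volume)]
  filter_upwards [b.ae_tendsto_avg (b.integrable_toLp u)] with x hx hxK σ hσ hσ1
  have hlim := ((hx hxK).sub_const (b.avg u.toLp σ x)).enorm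
  refine le_of_tendsto hlim ?_
  filter_upwards [Ioc_mem_nhdsGT hσ] with τ hτ
  rw [← enorm_neg, neg_sub]
  exact b.enorm_avg_sub_avg_le u hxK hτ.1 hτ.2 hσ1

/-- On the support of the kernel `|x - z| ≤ diam * σ`, so one of the two factors `σ⁻¹` may be traded
for `diam / |x - z|`. The averages can then be estimated with the same Young inequality as the
error. -/
theorem enorm_kern_le {σ : ℝ} (hσ : 0 < σ) {x : Plane} (hx : x ∈ K) (z : Plane) :
    ‖b.kern σ x z‖ₑ ≤
      ENNReal.ofReal (b.diam * b.bound * σ⁻¹) * rieszKernel (b.diam * σ) (x - z) := by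
  have hD := b.diam_pos
  have hB := b.bound_pos
  by_cases h : b.ψ (pull σ x z) = 0
  · simp [kern, h]
  · have hz := b.norm_sub_le_of_ne_zero hσ hx h
    rw [norm_sub_rev] at hz
    rw [rieszKernel_of_le hz]
    rcases eq_or_ne x z with rfl | hne
    · have : ENNReal.ofReal (b.diam * b.bound * σ⁻¹) ≠ 0 := by simp; positivity
      simp [ENNReal.mul_top this]
    · have hr0 : 0 < ‖x - z‖ := norm_pos_iff.2 (sub_ne_zero.2 hne)
      rw [← ofReal_norm, ← ofReal_norm, ← ENNReal.ofReal_inv_of_pos hr0,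
        ← ENNReal.ofReal_mul (by positivity), Real.norm_of_nonneg (b.kern_nonneg _ _ _)]
      refine ENNReal.ofReal_le_ofReal ((b.kern_le _ _ _).trans ?_)
      have : σ⁻¹ ≤ b.diam * ‖x - z‖⁻¹ := by
        rw [← div_eq_mul_inv, le_div_iff₀ hr0, inv_mul_le_iff₀ hσ, mul_comm]; exact hz
      calc σ⁻¹ ^ 2 * b.bound = b.bound * σ⁻¹ * σ⁻¹ := by ring
        _ ≤ b.bound * σ⁻¹ * (b.diam * ‖x - z‖⁻¹) := by gcongr
        _ = _ := by ring

theorem enorm_avg_le (u : Plane → ℝ) {σ : ℝ} (hσ : 0 < σ) {x : Plane} (hx : x ∈ K) :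
    ‖b.avg u σ x‖ₑ ≤ ENNReal.ofReal (b.diam * b.bound * σ⁻¹) *
      ∫⁻ z in Ω, rieszKernel (b.diam * σ) (x - z) * ‖u z‖ₑ := by
  refine (enorm_integral_le_lintegral_enorm _).trans ?_
  rw [← lintegral_const_mul' _ _ ENNReal.ofReal_ne_top]
  refine lintegral_mono fun z => ?_
  dsimp only
  rw [enorm_mul, mul_comm, ← mul_assoc]
  gcongr
  exact b.enorm_kern_le hσ hx z

/-- Approximation of a Sobolev function by its averages, in `L⁴(K)`. -/
theorem exists_lintegral_sub_avg_le : ∃ A : ℝ, 0 ≤ A ∧ ∀ (u : H1 Ω) (σ : ℝ), 0 < σ → σ ≤ 1 →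
    ∫⁻ x in K, ‖u.toLp x - b.avg u.toLp σ x‖ₑ ^ 4 ≤
      ENNReal.ofReal (A * (σ ^ 2 * gradSq u ^ 2)) := by
  have hD := b.diam_pos
  have hB := b.bound_pos
  set I := (∫⁻ y, rieszKernel 1 y ^ (4 / 3 : ℝ)) ^ 3
  have hI : I ≠ ⊤ := ENNReal.pow_ne_top lintegral_rieszKernel_one_lt_top.ne
  refine ⟨(b.diam ^ 2 * b.bound) ^ 4 * (b.diam ^ 2 * I.toReal), by positivity, fun u σ hσ hσ1 => ?_⟩
  calc ∫⁻ x in K, ‖u.toLp x - b.avg u.toLp σ x‖ₑ ^ 4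
      ≤ ∫⁻ x in K, ENNReal.ofReal (b.diam ^ 2 * b.bound) ^ 4 *
          (∫⁻ z in Ω, rieszKernel (b.diam * σ) (x - z) * ‖u.grad z‖ₑ) ^ 4 := by
        refine lintegral_mono_ae ?_
        filter_upwards [b.ae_enorm_sub_avg_le u] with x hx
        rw [← mul_pow]
        gcongr
        exact hx σ hσ hσ1
    _ ≤ ENNReal.ofReal (b.diam ^ 2 * b.bound) ^ 4 *
          ∫⁻ x, (∫⁻ z in Ω, rieszKernel (b.diam * σ) (x - z) * ‖u.grad z‖ₑ) ^ 4 := by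
        rw [lintegral_const_mul' _ _ (ENNReal.pow_ne_top ENNReal.ofReal_ne_top)]
        exact mul_le_mul_right (setLIntegral_le_lintegral _ _) _
    _ ≤ ENNReal.ofReal (b.diam ^ 2 * b.bound) ^ 4 *
          (ENNReal.ofReal ((b.diam * σ) ^ 2) * I * (ENNReal.ofReal (‖u.grad‖ ^ 2)) ^ 2) := by
        gcongr
        rw [← lintegral_rieszKernel (by positivity), ← lintegral_enorm_sq_eq]
        exact lintegral_convolution_pow_four_le (measurable_rieszKernel _)
          (Lp.aestronglyMeasurable u.grad).enorm
    _ = _ := by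
        rw [← ENNReal.ofReal_toReal hI, ← ENNReal.ofReal_pow (by positivity),
          ← ENNReal.ofReal_pow (by positivity), ← ENNReal.ofReal_mul (by positivity),
          ← ENNReal.ofReal_mul (by positivity), ← ENNReal.ofReal_mul (by positivity), gradSq]
        congr 1
        rw [ENNReal.toReal_ofReal (by positivity)]
        ring

/-- The prefactor `σ⁻¹` of the kernel bound contributes `σ⁻⁴` and Young's inequality contributes
`σ²`. -/
theorem exists_lintegral_avg_le : ∃ A : ℝ, 0 ≤ A ∧ ∀ (u : H1 Ω) (σ : ℝ), 0 < σ →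
    ∫⁻ x in K, ‖b.avg u.toLp σ x‖ₑ ^ 4 ≤ ENNReal.ofReal (A * (σ⁻¹ ^ 2 * mass u ^ 2)) := by
  have hD := b.diam_pos
  have hB := b.bound_pos
  set I := (∫⁻ y, rieszKernel 1 y ^ (4 / 3 : ℝ)) ^ 3
  have hI : I ≠ ⊤ := ENNReal.pow_ne_top lintegral_rieszKernel_one_lt_top.ne
  refine ⟨(b.diam * b.bound) ^ 4 * (b.diam ^ 2 * I.toReal), by positivity, fun u σ hσ => ?_⟩
  calc ∫⁻ x in K, ‖b.avg u.toLp σ x‖ₑ ^ 4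
      ≤ ∫⁻ x in K, ENNReal.ofReal (b.diam * b.bound * σ⁻¹) ^ 4 *
          (∫⁻ z in Ω, rieszKernel (b.diam * σ) (x - z) * ‖u.toLp z‖ₑ) ^ 4 := by
        refine lintegral_mono_ae ?_
        refine (ae_restrict_iff'₀ (b.convex.nullMeasurableSet volume)).2 ?_
        refine Eventually.of_forall fun x hx => ?_
        rw [← mul_pow]
        gcongr
        exact b.enorm_avg_le _ hσ hx
    _ ≤ ENNReal.ofReal (b.diam * b.bound * σ⁻¹) ^ 4 *
          ∫⁻ x, (∫⁻ z in Ω, rieszKernel (b.diam * σ) (x - z) * ‖u.toLp z‖ₑ) ^ 4 := by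
        rw [lintegral_const_mul' _ _ (ENNReal.pow_ne_top ENNReal.ofReal_ne_top)]
        exact mul_le_mul_right (setLIntegral_le_lintegral _ _) _
    _ ≤ ENNReal.ofReal (b.diam * b.bound * σ⁻¹) ^ 4 *
          (ENNReal.ofReal ((b.diam * σ) ^ 2) * I * (ENNReal.ofReal (‖u.toLp‖ ^ 2)) ^ 2) := by
        gcongr
        rw [← lintegral_rieszKernel (by positivity), ← lintegral_enorm_sq_eq]
        exact lintegral_convolution_pow_four_le (measurable_rieszKernel _)
          (Lp.aestronglyMeasurable u.toLp).enorm
    _ = _ := by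
        rw [← ENNReal.ofReal_toReal hI, ← ENNReal.ofReal_pow (by positivity),
          ← ENNReal.ofReal_pow (by positivity), ← ENNReal.ofReal_mul (by positivity),
          ← ENNReal.ofReal_mul (by positivity), ← ENNReal.ofReal_mul (by positivity), mass]
        congr 1
        rw [ENNReal.toReal_ofReal (by positivity)]
        field_simp

end StarBump

/-! ### The inequalities of Ladyzhenskaya and Rellich -/

theorem mass_nonneg (u : H1 Ω) : 0 ≤ mass u := sq_nonneg _

theorem gradSq_nonneg (u : H1 Ω) : 0 ≤ gradSq u := sq_nonneg _

theorem add_pow_le_two_pow_mul (a b : ℝ≥0∞) (n : ℕ) : (a + b) ^ n ≤ 2 ^ n * (a ^ n + b ^ n) := by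
  rcases le_total a b with h | h
  · calc (a + b) ^ n ≤ (2 * b) ^ n := by rw [two_mul]; gcongr
      _ = 2 ^ n * b ^ n := mul_pow _ _ _
      _ ≤ _ := by gcongr; exact le_add_self
  · calc (a + b) ^ n ≤ (2 * a) ^ n := by rw [two_mul]; gcongr
      _ = 2 ^ n * a ^ n := mul_pow _ _ _
      _ ≤ _ := by gcongr; exact le_self_add

theorem setLIntegral_le_sum_of_cover {ι : Type*} [Fintype ι] {K : ι → Set Plane}
    (h : volume (Ω \ ⋃ i, K i) = 0) (f : Plane → ℝ≥0∞) :
    ∫⁻ x in Ω, f x ≤ ∑ i, ∫⁻ x in K i, f x := by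
  calc ∫⁻ x in Ω, f x ≤ ∫⁻ x in (⋃ i, K i) ∪ (Ω \ ⋃ i, K i), f x :=
        lintegral_mono_set (by rw [union_sdiff_self]; exact subset_union_right)
    _ ≤ (∫⁻ x in ⋃ i, K i, f x) + ∫⁻ x in Ω \ ⋃ i, K i, f x := lintegral_union_le _ _ _
    _ = ∫⁻ x in ⋃ i, K i, f x := by rw [Measure.restrict_eq_zero.2 h]; simp
    _ ≤ ∑' i, ∫⁻ x in K i, f x := lintegral_iUnion_le _ _
    _ = _ := tsum_fintype _

namespace StarBump

variable {K : Set Plane} (b : StarBump Ω K)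

theorem aestronglyMeasurable_avg {u : Plane → ℝ} (hu : AEStronglyMeasurable u (volume.restrict Ω))
    (σ : ℝ) (μ : Measure Plane) [SFinite μ] : AEStronglyMeasurable (b.avg u σ) μ := by
  refine AEStronglyMeasurable.integral_prod_right' (f := fun p : Plane × Plane =>
    u p.2 * b.kern σ p.1 p.2) ?_
  refine hu.comp_snd.mul (Continuous.aestronglyMeasurable ?_)
  have : Continuous fun p : Plane × Plane => pull σ p.1 p.2 := by unfold pull; fun_prop
  exact continuous_const.mul (b.contDiff.continuous.comp this)

theorem lintegral_pow_le (u : H1 Ω) (σ : ℝ) (n : ℕ) :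
    ∫⁻ x in K, ‖u.toLp x‖ₑ ^ n ≤ 2 ^ n * ((∫⁻ x in K, ‖u.toLp x - b.avg u.toLp σ x‖ₑ ^ n) +
      ∫⁻ x in K, ‖b.avg u.toLp σ x‖ₑ ^ n) := by
  have hm : AEMeasurable (fun x => ‖b.avg u.toLp σ x‖ₑ ^ n) (volume.restrict K) :=
    (b.aestronglyMeasurable_avg (Lp.aestronglyMeasurable u.toLp) σ _).enorm.pow_const n
  rw [← lintegral_add_right' _ hm, ← lintegral_const_mul' _ _ (by finiteness)]
  refine lintegral_mono fun x => ?_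
  refine le_trans ?_ (add_pow_le_two_pow_mul _ _ n)
  gcongr
  simpa using enorm_add_le (u.toLp x - b.avg u.toLp σ x) (b.avg u.toLp σ x)

include b in
-- The error contributes `σ² gradSq²` and the average `σ⁻² mass²`; a scale that balances them gives
-- the product form, whose factor `mass u` is what later absorbs gradients.
theorem exists_lintegral_pow_four_le : ∃ A : ℝ, 0 ≤ A ∧ ∀ u : H1 Ω,
    ∫⁻ x in K, ‖u.toLp x‖ₑ ^ 4 ≤ ENNReal.ofReal (A * (mass u * (mass u + gradSq u))) := by
  obtain ⟨A₁, hA₁, h₁⟩ := b.exists_lintegral_sub_avg_le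
  obtain ⟨A₂, hA₂, h₂⟩ := b.exists_lintegral_avg_le
  refine ⟨16 * (A₁ + A₂), by positivity, fun u => ?_⟩
  have hm := mass_nonneg u
  have hg := gradSq_nonneg u
  rcases hm.eq_or_lt with hm0 | hm0
  · have h0 : u.toLp = 0 := by
      have : ‖u.toLp‖ ^ 2 = 0 := hm0.symm
      simpa using this
    have h1 : ∀ᵐ x ∂volume.restrict K, u.toLp x = 0 := by
      refine ae_restrict_of_ae_restrict_of_subset b.subset ?_
      rw [h0]
      exact Lp.coeFn_zero ℝ 2 _
    have : ∫⁻ x in K, ‖u.toLp x‖ₑ ^ 4 = 0 := by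
      refine (lintegral_congr_ae ?_).trans lintegral_zero
      filter_upwards [h1] with x hx
      simp [hx]
    rw [this]
    exact zero_le
  · set N := mass u + gradSq u
    have hN : 0 < N := by positivity
    -- The balance would be `σ² = mass / gradSq`; adding the mass to the denominator ensures `σ ≤
    -- 1`.
    set σ := Real.sqrt (mass u / N)
    have hσ2 : σ ^ 2 = mass u / N := Real.sq_sqrt (by positivity)
    have hσ : 0 < σ := Real.sqrt_pos.2 (by positivity)
    have hσ1 : σ ≤ 1 := by
      rw [Real.sqrt_le_one]
      rw [div_le_one hN]
      linarith
    refine (b.lintegral_pow_le u σ 4).trans ?_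
    refine (mul_le_mul_right (add_le_add (h₁ u σ hσ hσ1) (h₂ u σ hσ)) _).trans ?_
    rw [← ENNReal.ofReal_add (by positivity) (by positivity),
      show (2 : ℝ≥0∞) ^ 4 = ENNReal.ofReal 16 by norm_num, ← ENNReal.ofReal_mul (by norm_num)]
    refine ENNReal.ofReal_le_ofReal ?_
    rw [inv_pow, hσ2, inv_div, mul_assoc]
    have e1 : mass u / N * gradSq u ^ 2 ≤ mass u * N := by
      rw [div_mul_eq_mul_div, div_le_iff₀ hN, mul_assoc]
      have : gradSq u ≤ N := by linarith
      gcongr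
      nlinarith
    have e2 : N / mass u * mass u ^ 2 = mass u * N := by field_simp
    rw [e2]
    have := mul_le_mul_of_nonneg_left e1 hA₁
    linarith

/-- At a fixed scale and point, the average is the inner product of `u n` with a fixed `L²`
function. Weak convergence gives pointwise convergence, and the uniform bound on the kernel gives
domination. -/
theorem lintegral_sq_avg_tendsto_zero {u : ℕ → H1 Ω} {M : ℝ} (hM : ∀ n, mass (u n) ≤ M)
    (hw : ∀ g : Lp ℝ 2 (volume.restrict Ω),
      Tendsto (fun n => inner ℝ g (u n).toLp) atTop (𝓝 0)) (σ : ℝ) :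
    Tendsto (fun n => ∫⁻ x in K, ‖b.avg (u n).toLp σ x‖ₑ ^ 2) atTop (𝓝 0) := by
  have hfin := b.isFiniteMeasure
  have hB := b.bound_pos
  have hbd : ∀ x z, ‖b.kern σ x z‖ ≤ σ⁻¹ ^ 2 * b.bound := fun x z => by
    rw [Real.norm_of_nonneg (b.kern_nonneg _ _ _)]; exact b.kern_le _ _ _
  have hmem : ∀ x, MemLp (b.kern σ x) 2 (volume.restrict Ω) := fun x =>
    MemLp.of_bound (b.continuous_kern σ x).aestronglyMeasurable _ (Eventually.of_forall (hbd x))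
  have havg : ∀ n x, b.avg (u n).toLp σ x = inner ℝ ((hmem x).toLp _) (u n).toLp := fun n x => by
    rw [L2.inner_def, avg]
    refine integral_congr_ae ?_
    filter_upwards [(hmem x).coeFn_toLp] with z hz
    simp [hz]
  set C : ℝ := (volume.restrict Ω).real univ ^ (2 : ℝ≥0∞).toReal⁻¹ * (σ⁻¹ ^ 2 * b.bound)
  have hC : ∀ x, ‖(hmem x).toLp _‖ ≤ C := fun x => by
    refine Lp.norm_le_of_ae_bound (by positivity) ?_
    filter_upwards [(hmem x).coeFn_toLp] with z hz
    rw [hz]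
    exact hbd x z
  have hu : ∀ n, ‖(u n).toLp‖ ≤ Real.sqrt M := fun n => Real.le_sqrt_of_sq_le (hM n)
  have hlim := tendsto_lintegral_of_dominated_convergence' (μ := volume.restrict K)
    (F := fun n x => ‖b.avg (u n).toLp σ x‖ₑ ^ 2) (f := fun _ => 0)
    (fun _ => ENNReal.ofReal (C * Real.sqrt M) ^ 2)
    (fun n => (b.aestronglyMeasurable_avg (Lp.aestronglyMeasurable (u n).toLp) σ _).enorm.pow_const 2)
    (fun n => Eventually.of_forall fun x => ?_) ?_ (Eventually.of_forall fun x => ?_)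
  · simpa using hlim
  · dsimp only
    gcongr
    rw [havg, ← ofReal_norm]
    refine ENNReal.ofReal_le_ofReal ((norm_inner_le_norm _ _).trans ?_)
    exact mul_le_mul (hC x) (hu n) (norm_nonneg _) ((norm_nonneg _).trans (hC x))
  · rw [setLIntegral_const]
    exact ENNReal.mul_ne_top (by finiteness) ((measure_mono b.subset).trans_lt b.volume_lt_top).ne
  · have := ENNReal.Tendsto.pow (n := 2) (hw ((hmem x).toLp _)).enorm
    simp only [enorm_zero] at this
    simpa only [havg, ne_eq, OfNat.ofNat_ne_zero, not_false_eq_true, zero_pow] using this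

include b in
-- A small scale makes the error small uniformly in `n`, by the `L⁴` bound and Cauchy–Schwarz on a
-- set of finite area; at that fixed scale the averages vanish in the limit.
theorem lintegral_sq_tendsto_zero {u : ℕ → H1 Ω} {M : ℝ} (hM : ∀ n, mass (u n) ≤ M)
    (hG : ∀ n, gradSq (u n) ≤ M)
    (hw : ∀ g : Lp ℝ 2 (volume.restrict Ω),
      Tendsto (fun n => inner ℝ g (u n).toLp) atTop (𝓝 0)) :
    Tendsto (fun n => ∫⁻ x in K, ‖(u n).toLp x‖ₑ ^ 2) atTop (𝓝 0) := by
  obtain ⟨A, hA, h₁⟩ := b.exists_lintegral_sub_avg_le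
  have hvol : volume K ≠ ⊤ := ((measure_mono b.subset).trans_lt b.volume_lt_top).ne
  rw [ENNReal.tendsto_nhds_zero]
  intro ε hε
  have hlim : Tendsto (fun σ : ℝ => ENNReal.ofReal (A * (σ ^ 2 * M ^ 2)) * volume K) (𝓝[>] 0)
      (𝓝 0) := by
    have h1 : Tendsto (fun σ : ℝ => A * (σ ^ 2 * M ^ 2)) (𝓝[>] 0) (𝓝 0) := by
      have : Continuous fun σ : ℝ => A * (σ ^ 2 * M ^ 2) := by fun_prop
      have := this.tendsto 0
      simp only [ne_eq, OfNat.ofNat_ne_zero, not_false_eq_true, zero_pow, zero_mul, mul_zero] at this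
      exact this.mono_left nhdsWithin_le_nhds
    have h2 := ENNReal.Tendsto.mul_const (ENNReal.tendsto_ofReal h1) (Or.inr hvol)
    simpa using h2
  have hε8 : 0 < ε / 8 := ENNReal.div_pos hε.ne' (by simp)
  have hpos : 0 < (ε / 8) ^ 2 := ENNReal.pow_pos hε8 2
  obtain ⟨σ, hσlt, hσ, hσ1⟩ := ((hlim.eventually (gt_mem_nhds hpos)).and
    (Ioc_mem_nhdsGT (zero_lt_one' ℝ))).exists
  have hfirst : ∀ n, ∫⁻ x in K, ‖(u n).toLp x - b.avg (u n).toLp σ x‖ₑ ^ 2 ≤ ε / 8 := by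
    intro n
    by_contra! hcon
    have hm : AEMeasurable (fun x => ‖(u n).toLp x - b.avg (u n).toLp σ x‖ₑ ^ 2)
        (volume.restrict K) := by
      have h1 : AEStronglyMeasurable (u n).toLp (volume.restrict K) :=
        (Lp.aestronglyMeasurable (u n).toLp).mono_measure (Measure.restrict_mono_set _ b.subset)
      exact (h1.sub (b.aestronglyMeasurable_avg
        (Lp.aestronglyMeasurable (u n).toLp) σ _)).enorm.pow_const 2
    have hcs := sq_lintegral_mul_le hm (aemeasurable_const (b := (1 : ℝ≥0∞)))
    simp only [mul_one, one_pow, ← pow_mul, lintegral_one, Measure.restrict_apply_univ] at hcs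
    have h2 := hcs.trans (mul_le_mul_left (h₁ (u n) σ hσ hσ1) _)
    have h3 : ENNReal.ofReal (A * (σ ^ 2 * gradSq (u n) ^ 2)) * volume K ≤
        ENNReal.ofReal (A * (σ ^ 2 * M ^ 2)) * volume K := by
      have := gradSq_nonneg (u n)
      gcongr
      exact hG n
    exact absurd ((h2.trans h3).trans_lt hσlt) (not_lt.2 (by gcongr))
  have hsecond := (ENNReal.tendsto_nhds_zero.1 (b.lintegral_sq_avg_tendsto_zero hM hw σ)) (ε / 8) hε8
  filter_upwards [hsecond] with n hn
  refine (b.lintegral_pow_le (u n) σ 2).trans ?_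
  calc 2 ^ 2 * ((∫⁻ x in K, ‖(u n).toLp x - b.avg (u n).toLp σ x‖ₑ ^ 2) +
        ∫⁻ x in K, ‖b.avg (u n).toLp σ x‖ₑ ^ 2)
      ≤ 2 ^ 2 * (ε / 8 + ε / 8) := by gcongr; exact hfirst n
    _ = 8 * (ε / 8) := by ring
    _ = ε := ENNReal.mul_div_cancel (by simp) (by simp)

end StarBump

/-- **Ladyzhenskaya's inequality** on a polygonal domain. -/
theorem IsPolygonalDomain.exists_lintegral_pow_four_le (hΩ : IsPolygonalDomain Ω) :
    ∃ A : ℝ, 0 ≤ A ∧ ∀ u : H1 Ω,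
      ∫⁻ x in Ω, ‖u.toLp x‖ₑ ^ 4 ≤ ENNReal.ofReal (A * (mass u * (mass u + gradSq u))) := by
  obtain ⟨ι, _, K, hK, hnull⟩ := hΩ.exists_convex_cover
  have hb := fun i => exists_starBump hΩ.1 hΩ.2.2.1 (hK i).1 (hK i).2.1 (hK i).2.2.1 (hK i).2.2.2
  choose A hA h using fun i => (hb i).some.exists_lintegral_pow_four_le
  refine ⟨∑ i, A i, Finset.sum_nonneg fun i _ => hA i, fun u => ?_⟩
  have hm := mass_nonneg u
  have hg := gradSq_nonneg u
  refine (setLIntegral_le_sum_of_cover hnull _).trans ?_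
  rw [Finset.sum_mul, ENNReal.ofReal_sum_of_nonneg fun i _ => mul_nonneg (hA i) (by positivity)]
  exact Finset.sum_le_sum fun i _ => h i u

/-- **Rellich's theorem** on a polygonal domain, for sequences that converge weakly to `0`. -/
theorem IsPolygonalDomain.tendsto_mass_zero (hΩ : IsPolygonalDomain Ω) {u : ℕ → H1 Ω} {M : ℝ}
    (hM : ∀ n, mass (u n) ≤ M) (hG : ∀ n, gradSq (u n) ≤ M)
    (hw : ∀ g : Lp ℝ 2 (volume.restrict Ω),
      Tendsto (fun n => inner ℝ g (u n).toLp) atTop (𝓝 0)) :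
    Tendsto (fun n => mass (u n)) atTop (𝓝 0) := by
  obtain ⟨ι, _, K, hK, hnull⟩ := hΩ.exists_convex_cover
  have hb := fun i => exists_starBump hΩ.1 hΩ.2.2.1 (hK i).1 (hK i).2.1 (hK i).2.2.1 (hK i).2.2.2
  have h1 : Tendsto (fun n => ∑ i, ∫⁻ x in K i, ‖(u n).toLp x‖ₑ ^ 2) atTop (𝓝 0) := by
    have := tendsto_finsetSum Finset.univ fun i _ =>
      (hb i).some.lintegral_sq_tendsto_zero hM hG hw
    simpa using this
  have h2 : Tendsto (fun n => ENNReal.ofReal (mass (u n))) atTop (𝓝 0) := by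
    refine tendsto_of_tendsto_of_tendsto_of_le_of_le tendsto_const_nhds h1 (fun _ => zero_le)
      fun n => ?_
    dsimp only [mass]
    rw [← lintegral_enorm_sq_eq]
    exact setLIntegral_le_sum_of_cover hnull _
  have h3 := (ENNReal.tendsto_toReal ENNReal.zero_ne_top).comp h2
  simpa [Function.comp_def, ENNReal.toReal_ofReal (mass_nonneg _)] using h3

/-! ### Operations on Sobolev functions, and constants -/

/-- The two sides of the weak gradient identity are continuous linear functionals on `L²`. -/
theorem exists_inner_eq_integral {φ : Plane → ℝ} (hφ : ContDiff ℝ ∞ φ) (hc : HasCompactSupport φ)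
    (w : Plane) :
    ∃ (a : Lp ℝ 2 (volume.restrict Ω)) (b : Lp Plane 2 (volume.restrict Ω)),
      ∀ (u : Lp ℝ 2 (volume.restrict Ω)) (G : Lp Plane 2 (volume.restrict Ω)),
        ∫ x in Ω, u x * fderiv ℝ φ x w = inner ℝ a u ∧
          ∫ x in Ω, inner ℝ (G x) w * φ x = inner ℝ b G := by
  have h1 : MemLp (fun x => fderiv ℝ φ x w) 2 (volume.restrict Ω) :=
    ((hφ.continuous_fderiv (by simp)).clm_apply continuous_const).memLp_of_hasCompactSupport
      (hc.fderiv_apply (𝕜 := ℝ) w)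
  have h2 : MemLp (fun x => φ x • w) 2 (volume.restrict Ω) :=
    (hφ.continuous.smul continuous_const).memLp_of_hasCompactSupport hc.smul_right
  refine ⟨h1.toLp _, h2.toLp _, fun u G => ⟨?_, ?_⟩⟩
  · rw [L2.inner_def]
    refine integral_congr_ae ?_
    filter_upwards [h1.coeFn_toLp] with x hx
    simp [hx]
  · rw [L2.inner_def]
    refine integral_congr_ae ?_
    filter_upwards [h2.coeFn_toLp] with x hx
    rw [hx, real_inner_smul_left, real_inner_comm, mul_comm]

namespace H1

/-- The difference of two Sobolev functions. -/
def sub (u v : H1 Ω) : H1 Ω where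
  toLp := u.toLp - v.toLp
  grad := u.grad - v.grad
  isWeakGradient := fun φ hφ hc hs w => by
    obtain ⟨a, b, h⟩ := exists_inner_eq_integral (Ω := Ω) hφ hc w
    have hu := u.isWeakGradient φ hφ hc hs w
    have hv := v.isWeakGradient φ hφ hc hs w
    rw [(h u.toLp u.grad).1, (h u.toLp u.grad).2] at hu
    rw [(h v.toLp v.grad).1, (h v.toLp v.grad).2] at hv
    rw [(h _ (u.grad - v.grad)).1, (h (u.toLp - v.toLp) _).2, inner_sub_right, inner_sub_right,
      hu, hv]
    ring

/-- The product of a real number and a Sobolev function. -/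
def smul (c : ℝ) (u : H1 Ω) : H1 Ω where
  toLp := c • u.toLp
  grad := c • u.grad
  isWeakGradient := fun φ hφ hc hs w => by
    obtain ⟨a, b, h⟩ := exists_inner_eq_integral (Ω := Ω) hφ hc w
    have hu := u.isWeakGradient φ hφ hc hs w
    rw [(h u.toLp u.grad).1, (h u.toLp u.grad).2] at hu
    rw [(h _ (c • u.grad)).1, (h (c • u.toLp) _).2, inner_smul_right, inner_smul_right, hu]
    ring

theorem mass_smul (c : ℝ) (u : H1 Ω) : mass (smul c u) = c ^ 2 * mass u := by
  simp [mass, smul, norm_smul, mul_pow]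

theorem gradSq_smul (c : ℝ) (u : H1 Ω) : gradSq (smul c u) = c ^ 2 * gradSq u := by
  simp [gradSq, smul, norm_smul, mul_pow]

theorem lpPow_smul {c : ℝ} (hc : 0 ≤ c) (p : ℝ) (u : H1 Ω) :
    lpPow p (smul c u) = c ^ p * lpPow p u := by
  rw [lpPow, lpPow, ← integral_const_mul]
  refine integral_congr_ae ?_
  filter_upwards [Lp.coeFn_smul c u.toLp] with x hx
  simp only [smul, hx, Pi.smul_apply, smul_eq_mul]
  rw [abs_mul, Real.mul_rpow (abs_nonneg _) (abs_nonneg _), abs_of_nonneg hc]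

theorem mass_sub_le (u v : H1 Ω) : mass (sub u v) ≤ 2 * (mass u + mass v) := by
  have h : ‖u.toLp - v.toLp‖ ≤ ‖u.toLp‖ + ‖v.toLp‖ := norm_sub_le _ _
  have := norm_nonneg (u.toLp - v.toLp)
  simp only [mass, sub]
  nlinarith [sq_nonneg (‖u.toLp‖ - ‖v.toLp‖)]

theorem gradSq_sub_le (u v : H1 Ω) : gradSq (sub u v) ≤ 2 * (gradSq u + gradSq v) := by
  have h : ‖u.grad - v.grad‖ ≤ ‖u.grad‖ + ‖v.grad‖ := norm_sub_le _ _
  have := norm_nonneg (u.grad - v.grad)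
  simp only [gradSq, sub]
  nlinarith [sq_nonneg (‖u.grad‖ - ‖v.grad‖)]

end H1

theorem mass_pos_of_ne_zero {u : H1 Ω} (h : u.toLp ≠ 0) : 0 < mass u :=
  pow_pos (norm_pos_iff.2 h) 2

theorem toLp_ne_zero_of_mass_pos {u : H1 Ω} (h : 0 < mass u) : u.toLp ≠ 0 := by
  rintro h0
  simp [mass, h0] at h

theorem IsPolygonalDomain.isFiniteMeasure (hΩ : IsPolygonalDomain Ω) :
    IsFiniteMeasure (volume.restrict Ω) :=
  ⟨by simpa using hΩ.2.2.1.measure_lt_top⟩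

theorem IsPolygonalDomain.volume_real_pos (hΩ : IsPolygonalDomain Ω) : 0 < volume.real Ω :=
  ENNReal.toReal_pos (hΩ.1.measure_pos volume hΩ.2.1.nonempty).ne' hΩ.2.2.1.measure_lt_top.ne

/-- A polygonal domain carries a nonzero constant Sobolev function. -/
theorem IsPolygonalDomain.exists_const (hΩ : IsPolygonalDomain Ω) :
    ∃ u : H1 Ω, gradSq u = 0 ∧ mass u = volume.real Ω ∧ ∀ p, lpPow p u = volume.real Ω := by
  have := hΩ.isFiniteMeasure
  have h1 : MemLp (fun _ : Plane => (1 : ℝ)) 2 (volume.restrict Ω) := memLp_const 1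
  refine ⟨⟨h1.toLp _, 0, fun φ hφ hc hs w => ?_⟩, ?_, ?_, fun p => ?_⟩
  · have hl : ∫ x in Ω, h1.toLp _ x * fderiv ℝ φ x w = ∫ x, fderiv ℝ φ x w := by
      rw [← setIntegral_eq_integral_of_forall_compl_eq_zero (s := Ω)
        (f := fun x => fderiv ℝ φ x w)]
      · refine integral_congr_ae ?_
        filter_upwards [h1.coeFn_toLp] with x hx
        rw [hx, one_mul]
      · intro x hx
        have hx0 : fderiv ℝ φ x = 0 :=
          image_eq_zero_of_notMem_tsupport (f := fderiv ℝ φ)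
            fun h => hx (hs (tsupport_fderiv_subset ℝ (f := φ) h))
        simp [hx0]
    have hr : ∫ x in Ω, inner ℝ ((0 : Lp Plane 2 (volume.restrict Ω)) x) w * φ x = 0 := by
      refine (integral_congr_ae ?_).trans (integral_zero _ _)
      filter_upwards [Lp.coeFn_zero Plane 2 (volume.restrict Ω)] with x hx
      rw [hx]
      simp
    have hi : Integrable fun x => fderiv ℝ φ x w :=
      ((hφ.continuous_fderiv (by simp)).clm_apply continuous_const).integrable_of_hasCompactSupport
        (hc.fderiv_apply (𝕜 := ℝ) w)
    -- The integral of a directional derivative of a test function vanishes: integration by parts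
    -- over the plane against the constant `1`.
    have hp := integral_mul_fderiv_eq_neg_fderiv_mul_of_integrable (μ := (volume : Measure Plane))
      (f := fun _ => (1 : ℝ)) (g := φ) (v := w) (by simp) (by simpa using hi)
      (by simpa using hφ.continuous.integrable_of_hasCompactSupport hc) (fun _ _ => by fun_prop)
      (fun x _ => (hφ.differentiable (by simp)) x)
    rw [hl, hr]
    simpa using hp
  · simp [gradSq]
  · have h2 := lintegral_enorm_sq_eq (h1.toLp _)
    have h3 : ∫⁻ x in Ω, ‖h1.toLp _ x‖ₑ ^ 2 = volume Ω := by
      have : ∀ᵐ x ∂volume.restrict Ω, ‖h1.toLp _ x‖ₑ ^ 2 = 1 := by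
        filter_upwards [h1.coeFn_toLp] with x hx
        rw [hx]
        simp
      rw [lintegral_congr_ae this]
      simp
    rw [h3] at h2
    rw [mass, measureReal_def, h2, ENNReal.toReal_ofReal (sq_nonneg _)]
  · have : ∀ᵐ x ∂volume.restrict Ω, |h1.toLp _ x| ^ p = 1 := by
      filter_upwards [h1.coeFn_toLp] with x hx
      rw [hx]
      simp
    rw [lpPow, integral_congr_ae this]
    simp

/-! ### Powers of the `L^q` norm for `2 ≤ q ≤ 4` -/

theorem lpPow_nonneg (p : ℝ) (u : H1 Ω) : 0 ≤ lpPow p u :=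
  integral_nonneg fun _ => by positivity

theorem ofReal_mass (u : H1 Ω) : ENNReal.ofReal (mass u) = ∫⁻ x in Ω, ‖u.toLp x‖ₑ ^ 2 :=
  (lintegral_enorm_sq_eq u.toLp).symm

theorem lpPow_two (u : H1 Ω) : lpPow 2 u = mass u := by
  rw [lpPow, integral_eq_lintegral_of_nonneg_ae (Eventually.of_forall fun _ => by positivity),
    ← ENNReal.toReal_ofReal (mass_nonneg u), ofReal_mass]
  · congr 1
    refine lintegral_congr fun x => ?_
    rw [← ENNReal.ofReal_rpow_of_nonneg (abs_nonneg _) (by norm_num), ← Real.enorm_eq_ofReal_abs]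
    norm_num
  · exact ((Lp.aestronglyMeasurable u.toLp).norm.aemeasurable.pow_const (2 : ℝ)).aestronglyMeasurable

theorem IsPolygonalDomain.memLp_four (hΩ : IsPolygonalDomain Ω) (u : H1 Ω) :
    MemLp u.toLp 4 (volume.restrict Ω) := by
  obtain ⟨A, hA, h⟩ := hΩ.exists_lintegral_pow_four_le
  refine ⟨Lp.aestronglyMeasurable u.toLp, ?_⟩
  rw [eLpNorm_lt_top_iff_lintegral_rpow_enorm_lt_top (by simp) (by simp)]
  refine lt_of_le_of_lt (le_of_eq ?_) ((h u).trans_lt ENNReal.ofReal_lt_top)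
  simp

theorem IsPolygonalDomain.memLp (hΩ : IsPolygonalDomain Ω) (u : H1 Ω) {q : ℝ} (hq : q ≤ 4) :
    MemLp u.toLp (ENNReal.ofReal q) (volume.restrict Ω) := by
  have := hΩ.isFiniteMeasure
  refine (hΩ.memLp_four u).mono_exponent ?_
  rw [show (4 : ℝ≥0∞) = ENNReal.ofReal 4 by norm_num]
  exact ENNReal.ofReal_le_ofReal hq

theorem IsPolygonalDomain.integrable_rpow (hΩ : IsPolygonalDomain Ω) (u : H1 Ω) {q : ℝ}
    (hq0 : 0 ≤ q) (hq : q ≤ 4) : Integrable (fun x => |u.toLp x| ^ q) (volume.restrict Ω) := by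
  have := hΩ.isFiniteMeasure
  simpa [ENNReal.toReal_ofReal hq0] using (hΩ.memLp u hq).integrable_norm_rpow'

theorem IsPolygonalDomain.exists_lpPow_four_le (hΩ : IsPolygonalDomain Ω) :
    ∃ A : ℝ, 0 < A ∧ ∀ u : H1 Ω, lpPow 4 u ≤ A * (mass u * (mass u + gradSq u)) := by
  obtain ⟨A, hA, h⟩ := hΩ.exists_lintegral_pow_four_le
  refine ⟨A + 1, by positivity, fun u => ?_⟩
  have hm := mass_nonneg u
  have hg := gradSq_nonneg u
  refine le_trans ?_ (show A * (mass u * (mass u + gradSq u)) ≤ _ by gcongr; linarith)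
  rw [lpPow, integral_eq_lintegral_of_nonneg_ae (Eventually.of_forall fun _ => by positivity)
    (hΩ.integrable_rpow u (by norm_num) le_rfl).aestronglyMeasurable]
  refine ENNReal.toReal_le_of_le_ofReal (by positivity) (le_trans (le_of_eq ?_) (h u))
  refine lintegral_congr fun x => ?_
  rw [← ENNReal.ofReal_rpow_of_nonneg (abs_nonneg _) (by norm_num), ← Real.enorm_eq_ofReal_abs]
  norm_num

/-- Below the threshold `r` the first term dominates, above it the second. A free `r` allows a small
coefficient `r^(q - 4)` on the critical term when `q < 4`. -/
theorem rpow_le_interpolate {a r q : ℝ} (ha : 0 ≤ a) (hr : 0 < r) (hq2 : 2 ≤ q) (hq4 : q ≤ 4) :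
    a ^ q ≤ r ^ (q - 2) * a ^ (2 : ℝ) + r ^ (q - 4) * a ^ (4 : ℝ) := by
  rcases ha.eq_or_lt with rfl | ha
  · rw [Real.zero_rpow (by linarith)]
    positivity
  rcases le_total a r with h | h
  · have : a ^ q = a ^ (q - 2) * a ^ (2 : ℝ) := by rw [← Real.rpow_add ha]; ring_nf
    have h2 : a ^ (q - 2) ≤ r ^ (q - 2) := Real.rpow_le_rpow ha.le h (by linarith)
    rw [this]
    have : 0 ≤ r ^ (q - 4) * a ^ (4 : ℝ) := by positivity
    have : a ^ (q - 2) * a ^ (2 : ℝ) ≤ r ^ (q - 2) * a ^ (2 : ℝ) := by gcongr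
    linarith
  · have : a ^ q = a ^ (q - 4) * a ^ (4 : ℝ) := by rw [← Real.rpow_add ha]; ring_nf
    have h2 : a ^ (q - 4) ≤ r ^ (q - 4) := Real.rpow_le_rpow_of_nonpos hr h (by linarith)
    rw [this]
    have : 0 ≤ r ^ (q - 2) * a ^ (2 : ℝ) := by positivity
    have : a ^ (q - 4) * a ^ (4 : ℝ) ≤ r ^ (q - 4) * a ^ (4 : ℝ) := by gcongr
    linarith

theorem IsPolygonalDomain.lpPow_le (hΩ : IsPolygonalDomain Ω) (u : H1 Ω) {r q : ℝ} (hr : 0 < r)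
    (hq2 : 2 ≤ q) (hq4 : q ≤ 4) :
    lpPow q u ≤ r ^ (q - 2) * mass u + r ^ (q - 4) * lpPow 4 u := by
  have i2 := (hΩ.integrable_rpow u (q := 2) (by norm_num) (by norm_num)).const_mul (r ^ (q - 2))
  have i4 := (hΩ.integrable_rpow u (q := 4) (by norm_num) le_rfl).const_mul (r ^ (q - 4))
  rw [← lpPow_two, lpPow, lpPow, lpPow, ← integral_const_mul, ← integral_const_mul,
    ← integral_add i2 i4]
  exact integral_mono (hΩ.integrable_rpow u (by linarith) hq4) (i2.add i4) fun x =>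
    rpow_le_interpolate (abs_nonneg _) hr hq2 hq4

theorem IsPolygonalDomain.lpPow_rpow_inv (hΩ : IsPolygonalDomain Ω) (u : H1 Ω) {q : ℝ}
    (hq0 : 0 < q) (hq : q ≤ 4) :
    lpPow q u ^ q⁻¹ = (eLpNorm u.toLp (ENNReal.ofReal q) (volume.restrict Ω)).toReal := by
  rw [(hΩ.memLp u hq).eLpNorm_eq_integral_rpow_norm (by simpa using hq0) (by simp),
    ENNReal.toReal_ofReal (by positivity), ENNReal.toReal_ofReal hq0.le]
  rfl

/-- The reverse triangle inequality in `L^q`. -/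
theorem IsPolygonalDomain.abs_lpPow_sub_le (hΩ : IsPolygonalDomain Ω) (u v : H1 Ω) {q : ℝ}
    (hq1 : 1 ≤ q) (hq : q ≤ 4) :
    |lpPow q u ^ q⁻¹ - lpPow q v ^ q⁻¹| ≤ lpPow q (H1.sub u v) ^ q⁻¹ := by
  have hq0 : 0 < q := by linarith
  have h1 : (1 : ℝ≥0∞) ≤ ENNReal.ofReal q := by simpa using hq1
  have hae : (H1.sub u v).toLp =ᵐ[volume.restrict Ω] u.toLp - v.toLp := Lp.coeFn_sub _ _
  rw [hΩ.lpPow_rpow_inv u hq0 hq, hΩ.lpPow_rpow_inv v hq0 hq, hΩ.lpPow_rpow_inv _ hq0 hq,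
    eLpNorm_congr_ae hae]
  have hu := hΩ.memLp u hq
  have hv := hΩ.memLp v hq
  have e1 : eLpNorm u.toLp (ENNReal.ofReal q) (volume.restrict Ω) ≤
      eLpNorm (⇑u.toLp - ⇑v.toLp) (ENNReal.ofReal q) (volume.restrict Ω) +
        eLpNorm v.toLp (ENNReal.ofReal q) (volume.restrict Ω) := by
    have := eLpNorm_add_le (hu.1.sub hv.1) hv.1 h1
    rwa [sub_add_cancel] at this
  have e2 : eLpNorm v.toLp (ENNReal.ofReal q) (volume.restrict Ω) ≤
      eLpNorm (⇑u.toLp - ⇑v.toLp) (ENNReal.ofReal q) (volume.restrict Ω) +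
        eLpNorm u.toLp (ENNReal.ofReal q) (volume.restrict Ω) := by
    have := eLpNorm_add_le (hv.1.sub hu.1) hu.1 h1
    rw [sub_add_cancel] at this
    rwa [eLpNorm_sub_comm]
  have t1 := ENNReal.toReal_mono (ENNReal.add_ne_top.2 ⟨(hu.sub hv).2.ne, hv.2.ne⟩) e1
  have t2 := ENNReal.toReal_mono (ENNReal.add_ne_top.2 ⟨(hu.sub hv).2.ne, hu.2.ne⟩) e2
  rw [ENNReal.toReal_add (hu.sub hv).2.ne hv.2.ne] at t1
  rw [ENNReal.toReal_add (hu.sub hv).2.ne hu.2.ne] at t2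
  rw [abs_le]
  constructor <;> linarith

theorem IsPolygonalDomain.tendsto_lpPow_exponent (hΩ : IsPolygonalDomain Ω) (u : H1 Ω) {q : ℕ → ℝ}
    {p : ℝ} (hq : ∀ n, q n ∈ Icc 2 4) (hqp : Tendsto q atTop (𝓝 p)) :
    Tendsto (fun n => lpPow (q n) u) atTop (𝓝 (lpPow p u)) := by
  have hp : p ∈ Icc (2 : ℝ) 4 := isClosed_Icc.mem_of_tendsto hqp (Eventually.of_forall hq)
  have i2 := hΩ.integrable_rpow u (q := 2) (by norm_num) (by norm_num)
  have i4 := hΩ.integrable_rpow u (q := 4) (by norm_num) le_rfl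
  refine tendsto_integral_of_dominated_convergence _ (fun n => ?_) (i2.add i4) (fun n => ?_) ?_
  · exact (hΩ.integrable_rpow u (by linarith [(hq n).1]) (hq n).2).aestronglyMeasurable
  · refine Eventually.of_forall fun x => ?_
    rw [Real.norm_of_nonneg (by positivity)]
    simpa using rpow_le_interpolate (abs_nonneg (u.toLp x)) one_pos (hq n).1 (hq n).2
  · refine Eventually.of_forall fun x => ?_
    exact tendsto_const_nhds.rpow hqp (Or.inr (by linarith [hp.1]))

/-- The exponent may vary along the sequence, as the passage `p → 4` requires. Interpolation and
Ladyzhenskaya's inequality make the difference small in `L^(q n)`; the triangle inequality then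
reduces the claim to the fixed function `v`. -/
theorem IsPolygonalDomain.tendsto_lpPow (hΩ : IsPolygonalDomain Ω) {u : ℕ → H1 Ω} {v : H1 Ω}
    {q : ℕ → ℝ} {p M : ℝ} (hq : ∀ n, q n ∈ Icc 2 4) (hqp : Tendsto q atTop (𝓝 p))
    (hG : ∀ n, gradSq (H1.sub (u n) v) ≤ M)
    (hm : Tendsto (fun n => mass (H1.sub (u n) v)) atTop (𝓝 0)) :
    Tendsto (fun n => lpPow (q n) (u n)) atTop (𝓝 (lpPow p v)) := by
  have hp : p ∈ Icc (2 : ℝ) 4 := isClosed_Icc.mem_of_tendsto hqp (Eventually.of_forall hq)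
  have hp0 : 0 < p := by linarith [hp.1]
  have hq0 : ∀ n, 0 < q n := fun n => by linarith [(hq n).1]
  obtain ⟨A, hA, hA4⟩ := hΩ.exists_lpPow_four_le
  have hinv : Tendsto (fun n => (q n)⁻¹) atTop (𝓝 p⁻¹) := hqp.inv₀ hp0.ne'
  have hd : Tendsto (fun n => lpPow (q n) (H1.sub (u n) v)) atTop (𝓝 0) := by
    have hup : Tendsto (fun n => mass (H1.sub (u n) v) + A * (mass (H1.sub (u n) v) *
        (mass (H1.sub (u n) v) + M))) atTop (𝓝 0) := by
      simpa using hm.add ((hm.mul (hm.add_const M)).const_mul A)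
    refine tendsto_of_tendsto_of_tendsto_of_le_of_le tendsto_const_nhds hup
      (fun n => lpPow_nonneg _ _) fun n => ?_
    have h1 := hΩ.lpPow_le (H1.sub (u n) v) one_pos (hq n).1 (hq n).2
    simp only [Real.one_rpow, one_mul] at h1
    refine h1.trans (add_le_add le_rfl ((hA4 _).trans ?_))
    have := mass_nonneg (H1.sub (u n) v)
    gcongr
    exact hG n
  have hd' : Tendsto (fun n => lpPow (q n) (H1.sub (u n) v) ^ (q n)⁻¹) atTop (𝓝 0) := by
    have := hd.rpow hinv (Or.inr (inv_pos.2 hp0))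
    rwa [Real.zero_rpow (inv_pos.2 hp0).ne'] at this
  have hv := (hΩ.tendsto_lpPow_exponent v hq hqp).rpow hinv (Or.inr (inv_pos.2 hp0))
  have hdiff : Tendsto (fun n => lpPow (q n) (u n) ^ (q n)⁻¹ - lpPow (q n) v ^ (q n)⁻¹) atTop
      (𝓝 0) :=
    squeeze_zero_norm (fun n => hΩ.abs_lpPow_sub_le (u n) v (by linarith [(hq n).1]) (hq n).2) hd'
  have hu := (hdiff.add hv).rpow hqp (Or.inr hp0)
  simp only [sub_add_cancel, zero_add] at hu
  have e : ∀ (r : ℝ) (w : H1 Ω), 0 < r → (lpPow r w ^ r⁻¹) ^ r = lpPow r w := fun r w hr => by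
    rw [← Real.rpow_mul (lpPow_nonneg _ _), inv_mul_cancel₀ hr.ne', Real.rpow_one]
  simpa only [e _ _ (hq0 _), e _ _ hp0] using hu

/-! ### Weak compactness in `H¹` -/

/-- Bounded sequences in a separable Hilbert space have weakly convergent subsequences. -/
theorem exists_weakly_convergent_subseq {H : Type*} [NormedAddCommGroup H] [InnerProductSpace ℝ H]
    [CompleteSpace H] [TopologicalSpace.SeparableSpace H] {x : ℕ → H} {M : ℝ}
    (hM : ∀ n, ‖x n‖ ≤ M) :
    ∃ (y : H) (φ : ℕ → ℕ), StrictMono φ ∧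
      ∀ z, Tendsto (fun n => inner ℝ z (x (φ n))) atTop (𝓝 (inner ℝ z y)) := by
  have hs := WeakDual.isSeqCompact_closedBall ℝ H 0 M
  obtain ⟨a, -, φ, hφ, ha⟩ := hs
    (x := fun n => StrongDual.toWeakDual (InnerProductSpace.toDual ℝ H (x n))) fun n => by
      simpa using hM n
  refine ⟨(InnerProductSpace.toDual ℝ H).symm (WeakDual.toStrongDual a), φ, hφ, fun z => ?_⟩
  have h1 := ((WeakDual.eval_continuous z).tendsto a).comp ha
  rw [real_inner_comm, InnerProductSpace.toDual_symm_apply]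
  refine h1.congr fun n => ?_
  rw [real_inner_comm]
  rfl

/-- **Compactness**: bounded sequences in `H¹(Ω)` have subsequences that converge weakly in `H¹`
and strongly in `L^q` for `2 ≤ q ≤ 4`. -/
theorem IsPolygonalDomain.exists_subseq (hΩ : IsPolygonalDomain Ω) {u : ℕ → H1 Ω} {M : ℝ}
    (hM : ∀ n, mass (u n) ≤ M) (hG : ∀ n, gradSq (u n) ≤ M) :
    ∃ (v : H1 Ω) (φ : ℕ → ℕ) (ℓ : ℝ), StrictMono φ ∧
      Tendsto (fun n => mass (u (φ n))) atTop (𝓝 (mass v)) ∧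
      Tendsto (fun n => gradSq (u (φ n))) atTop (𝓝 ℓ) ∧ gradSq v ≤ ℓ ∧
      ∀ (q : ℕ → ℝ) (p : ℝ), (∀ n, q n ∈ Icc 2 4) → Tendsto q atTop (𝓝 p) →
        Tendsto (fun n => lpPow (q n) (u (φ n))) atTop (𝓝 (lpPow p v)) := by
  have : Fact ((2 : ℝ≥0∞) ≠ ⊤) := ⟨by simp⟩
  obtain ⟨y, φ₁, hφ₁, hy⟩ := exists_weakly_convergent_subseq (x := fun n => (u n).toLp)
    (M := Real.sqrt M) fun n => Real.le_sqrt_of_sq_le (hM n)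
  obtain ⟨g, φ₂, hφ₂, hg⟩ := exists_weakly_convergent_subseq (x := fun n => (u (φ₁ n)).grad)
    (M := Real.sqrt M) fun n => Real.le_sqrt_of_sq_le (hG _)
  obtain ⟨ℓ, -, φ₃, hφ₃, hℓ⟩ := tendsto_subseq_of_bounded (Metric.isBounded_Icc 0 M)
    (x := fun n => gradSq (u (φ₁ (φ₂ n)))) fun n => ⟨gradSq_nonneg _, hG _⟩
  set φ := fun n => φ₁ (φ₂ (φ₃ n)) with hφ
  have hy' : ∀ z, Tendsto (fun n => inner ℝ z (u (φ n)).toLp) atTop (𝓝 (inner ℝ z y)) := fun z =>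
    (hy z).comp ((hφ₂.comp hφ₃).tendsto_atTop)
  have hg' : ∀ z, Tendsto (fun n => inner ℝ z (u (φ n)).grad) atTop (𝓝 (inner ℝ z g)) := fun z =>
    (hg z).comp hφ₃.tendsto_atTop
  -- For each test function both sides of the weak gradient identity are continuous under weak
  -- convergence, so the identity passes to the limit.
  let v : H1 Ω := ⟨y, g, fun ψ hψ hc hs w => by
    obtain ⟨a, b, h⟩ := exists_inner_eq_integral (Ω := Ω) hψ hc w
    rw [(h y g).1, (h y g).2]
    refine tendsto_nhds_unique (hy' a) ((hg' b).neg.congr fun n => ?_)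
    rw [← (h (u (φ n)).toLp (u (φ n)).grad).1, ← (h (u (φ n)).toLp (u (φ n)).grad).2]
    exact ((u (φ n)).isWeakGradient ψ hψ hc hs w).symm⟩
  have hsubm : ∀ n, mass (H1.sub (u (φ n)) v) ≤ max (2 * (M + mass v)) (2 * (M + gradSq v)) :=
    fun n => (H1.mass_sub_le _ _).trans (le_trans (by linarith [hM (φ n)]) (le_max_left _ _))
  have hsubg : ∀ n, gradSq (H1.sub (u (φ n)) v) ≤ max (2 * (M + mass v)) (2 * (M + gradSq v)) :=
    fun n => (H1.gradSq_sub_le _ _).trans (le_trans (by linarith [hG (φ n)]) (le_max_right _ _))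
  have hzero : Tendsto (fun n => mass (H1.sub (u (φ n)) v)) atTop (𝓝 0) := by
    refine hΩ.tendsto_mass_zero hsubm hsubg fun z => ?_
    have := (hy' z).sub_const (inner ℝ z y)
    rw [sub_self] at this
    refine this.congr fun n => ?_
    rw [← inner_sub_right]
    rfl
  refine ⟨v, φ, ℓ, hφ₁.comp (hφ₂.comp hφ₃), ?_, hℓ, ?_, fun q p hq hqp =>
    hΩ.tendsto_lpPow hq hqp hsubg hzero⟩
  · have := hΩ.tendsto_lpPow (q := fun _ => 2) (p := 2) (fun _ => by norm_num) tendsto_const_nhds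
      hsubg hzero
    simpa only [lpPow_two] using this
  -- Lower semicontinuity, from the limit of `0 ≤ ‖∇u - g‖²`.
  · have h1 : Tendsto (fun n => gradSq (u (φ n)) - 2 * inner ℝ g (u (φ n)).grad + ‖g‖ ^ 2) atTop
        (𝓝 (ℓ - 2 * inner ℝ g g + ‖g‖ ^ 2)) :=
      (hℓ.sub ((hg' g).const_mul 2)).add_const _
    have h2 := ge_of_tendsto' h1 (b := 0) fun n => by
      have := norm_sub_sq_real (u (φ n)).grad g
      rw [real_inner_comm] at this
      rw [gradSq, ← this]
      positivity
    rw [real_inner_self_eq_norm_sq] at h2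
    change ‖g‖ ^ 2 ≤ ℓ
    linarith

/-! ### Energy ground states as action ground states -/

theorem mem_energyGroundStates_iff {p μ : ℝ} {u : H1 Ω} :
    u ∈ energyGroundStates Ω p μ ↔ mass u = μ ∧ ∀ v : H1 Ω, mass v = μ → energy p u ≤ energy p v := by
  refine and_congr_right fun hu => ⟨fun h v hv => ?_, fun h => le_antisymm ?_ ?_⟩
  · rw [← EReal.coe_le_coe_iff, h]
    exact iInf₂_le v hv
  · exact le_iInf₂ fun v hv => EReal.coe_le_coe_iff.2 (h v hv)
  · exact iInf₂_le u hu

theorem mem_actionGroundStates_iff {p lam : ℝ} {u : H1 Ω} :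
    u ∈ actionGroundStates Ω p lam ↔
      u ∈ nehari Ω p lam ∧ ∀ v ∈ nehari Ω p lam, action p lam u ≤ action p lam v := by
  refine and_congr_right fun hu => ⟨fun h v hv => ?_, fun h => le_antisymm ?_ ?_⟩
  · rw [← EReal.coe_le_coe_iff, h]
    exact iInf₂_le v hv
  · exact le_iInf₂ fun v hv => EReal.coe_le_coe_iff.2 (h v hv)
  · exact iInf₂_le u hu

theorem energy_smul {c : ℝ} (hc : 0 ≤ c) (p : ℝ) (u : H1 Ω) :
    energy p (H1.smul c u) = 1 / 2 * (c ^ 2 * gradSq u) - 1 / p * (c ^ p * lpPow p u) := by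
  rw [energy, H1.gradSq_smul, H1.lpPow_smul hc]

/-- On the Nehari manifold, the action is maximal along rays. -/
theorem ray_le {t p : ℝ} (ht : 0 ≤ t) (hp : 2 < p) :
    1 / 2 * t ^ 2 - 1 / p * t ^ p ≤ 1 / 2 - 1 / p := by
  -- Bernoulli's inequality with exponent `p / 2`, applied to `t² = 1 + (t² - 1)`.
  have h1 := one_add_mul_self_le_rpow_one_add (s := t ^ 2 - 1) (by nlinarith [sq_nonneg t])
    (p := p / 2) (by linarith)
  have h2 : (1 + (t ^ 2 - 1)) ^ (p / 2) = t ^ p := by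
    rw [add_sub_cancel, ← Real.rpow_natCast, ← Real.rpow_mul ht]
    congr 1
    push_cast
    ring
  rw [h2] at h1
  have hp0 : 0 < p := by linarith
  have h3 := mul_le_mul_of_nonneg_left h1 (show 0 ≤ 1 / p by positivity)
  have h4 : 1 / p * (1 + p / 2 * (t ^ 2 - 1)) = 1 / p + 1 / 2 * (t ^ 2 - 1) := by field_simp
  linarith

/-- An energy ground state is an action ground state at the frequency given by its multiplier. -/
theorem mem_actionGroundStates_of_mem_energyGroundStates {p μ : ℝ} (hp : 2 < p) (hμ : 0 < μ)
    {u : H1 Ω} (hu : u ∈ energyGroundStates Ω p μ) :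
    u ∈ actionGroundStates Ω p (multiplier p u) := by
  obtain ⟨hm, hmin⟩ := mem_energyGroundStates_iff.1 hu
  set lam := multiplier p u with hlam_def
  have hlam : gradSq u + lam * mass u = lpPow p u := by
    rw [hlam_def, multiplier, div_mul_cancel₀ _ (by rw [hm]; exact hμ.ne')]
    ring
  refine mem_actionGroundStates_iff.2 ⟨⟨toLp_ne_zero_of_mass_pos (hm ▸ hμ), hlam⟩, fun v hv => ?_⟩
  have hv0 := mass_pos_of_ne_zero hv.1
  have hvN : gradSq v + lam * mass v = lpPow p v := hv.2
  set t := Real.sqrt (μ / mass v)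
  have ht0 : 0 ≤ t := Real.sqrt_nonneg _
  have ht2 : t ^ 2 = μ / mass v := Real.sq_sqrt (by positivity)
  have ht2' : t ^ 2 * mass v = μ := by rw [ht2]; field_simp
  -- The competitor `v` is rescaled to mass `μ`. At that mass energy and action differ by the
  -- constant `lam * μ / 2`, so `J(u) ≤ J(t v)`, and `J(t v) ≤ J(v)` because the action on a ray
  -- peaks at the Nehari point.
  have h1 := hmin (H1.smul t v) (by rw [H1.mass_smul, ht2'])
  rw [energy_smul ht0] at h1
  have h2 := mul_le_mul_of_nonneg_right (ray_le ht0 hp) (lpPow_nonneg p v)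
  simp only [energy] at h1
  simp only [action]
  rw [hm]
  have h3 : t ^ 2 * gradSq v = t ^ 2 * lpPow p v - lam * μ := by rw [← hvN, ← ht2']; ring
  rw [h3] at h1
  have h4 : gradSq v = lpPow p v - lam * mass v := by linarith
  rw [h4]
  linarith

/-! ### Bounds on multipliers and gradients -/

theorem exists_rpow_eq {κ q : ℝ} (hκ : 0 < κ) (hq : q ≠ 0) : ∃ r : ℝ, 0 < r ∧ r ^ q = κ :=
  ⟨κ ^ q⁻¹, by positivity, Real.rpow_inv_rpow hκ.le hq⟩

/-- The constant of mass `μ`, as a competitor for the energy. -/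
theorem IsPolygonalDomain.multiplier_ge (hΩ : IsPolygonalDomain Ω) {p c : ℝ} (hp : 2 < p)
    (hc : 0 < c) {u : H1 Ω} (hu : u ∈ energyGroundStates Ω p (c ^ 2 * volume.real Ω)) :
    2 / p * c ^ (p - 2) ≤ multiplier p u := by
  have hV := hΩ.volume_real_pos
  obtain ⟨hm, hmin⟩ := mem_energyGroundStates_iff.1 hu
  obtain ⟨w, hw1, hw2, hw3⟩ := hΩ.exists_const
  have h1 := hmin (H1.smul c w) (by rw [H1.mass_smul, hw2])
  rw [energy_smul hc.le, hw1, hw3, energy] at h1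
  have hp0 : 0 < p := by linarith
  have hcp : c ^ p = c ^ (p - 2) * c ^ 2 := by
    rw [← Real.rpow_natCast, ← Real.rpow_add hc]
    norm_num
  rw [multiplier, hm, le_div_iff₀ (by positivity)]
  -- `multiplier * mass = -2 E + (1 - 2/p) ‖u‖_p^p`, so a negative upper bound on the energy is a
  -- lower bound on the multiplier.
  have h2 : 0 ≤ (1 - 2 / p) * lpPow p u :=
    mul_nonneg (by rw [sub_nonneg, div_le_one hp0]; exact hp.le) (lpPow_nonneg _ _)
  have h3 : 2 / p * c ^ (p - 2) * (c ^ 2 * volume.real Ω) =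
      2 * (1 / p * (c ^ p * volume.real Ω)) := by rw [hcp]; ring
  rw [h3]
  have h4 : 2 / p * lpPow p u = 2 * (1 / p * lpPow p u) := by ring
  linarith

theorem IsPolygonalDomain.multiplier_pos (hΩ : IsPolygonalDomain Ω) {p μ : ℝ} (hp : 2 < p)
    (hμ : 0 < μ) {u : H1 Ω} (hu : u ∈ energyGroundStates Ω p μ) : 0 < multiplier p u := by
  have hV := hΩ.volume_real_pos
  have hc : 0 < Real.sqrt (μ / volume.real Ω) := Real.sqrt_pos.2 (by positivity)
  have hc2 : Real.sqrt (μ / volume.real Ω) ^ 2 * volume.real Ω = μ := by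
    rw [Real.sq_sqrt (by positivity)]; field_simp
  refine lt_of_lt_of_le ?_ (hΩ.multiplier_ge hp hc (by rwa [hc2]))
  have : 0 < p := by linarith
  positivity

/-- The smallness condition lets `-gradSq u` in the multiplier absorb the gradient on the right of
the interpolation inequality. -/
theorem multiplier_le {p A r : ℝ} {u : H1 Ω} (hu : 0 < mass u)
    (h : lpPow p u ≤ r ^ (p - 2) * mass u + r ^ (p - 4) * (A * (mass u * (mass u + gradSq u))))
    (hr : r ^ (p - 4) * (A * mass u) ≤ 1) :
    multiplier p u ≤ r ^ (p - 2) + r ^ (p - 4) * (A * mass u) := by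
  rw [multiplier, div_le_iff₀ hu]
  have := mul_le_mul_of_nonneg_right hr (gradSq_nonneg u)
  nlinarith

theorem gradSq_le_of_energy {p A r : ℝ} {u : H1 Ω} (hp : 2 < p)
    (h : lpPow p u ≤ r ^ (p - 2) * mass u + r ^ (p - 4) * (A * (mass u * (mass u + gradSq u))))
    (hr : r ^ (p - 4) * (A * mass u) ≤ 1 / 2) :
    gradSq u ≤ 4 * energy p u + (2 * r ^ (p - 2) + 1) * mass u := by
  have h1 := mul_le_mul_of_nonneg_right hr (add_nonneg (mass_nonneg u) (gradSq_nonneg u))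
  have h2 : 1 / p * lpPow p u ≤ 1 / 2 * lpPow p u :=
    mul_le_mul_of_nonneg_right (one_div_le_one_div_of_le two_pos hp.le) (lpPow_nonneg _ _)
  rw [energy]
  nlinarith

/-- `H¹`-bounds from energy bounds in the subcritical regime. -/
theorem IsPolygonalDomain.exists_gradSq_le (hΩ : IsPolygonalDomain Ω) {p : ℝ} (hp : 2 < p)
    (hp4 : p < 4) (M : ℝ) :
    ∃ C, 0 ≤ C ∧ ∀ u : H1 Ω, mass u ≤ M → gradSq u ≤ 4 * energy p u + C * mass u := by
  obtain ⟨A, hA, h⟩ := hΩ.exists_lpPow_four_le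
  -- Subcriticality enters here: since `p - 4 ≠ 0`, the coefficient `r^(p - 4)` can be prescribed,
  -- for any bound on the mass.
  obtain ⟨r, hr0, hr⟩ := exists_rpow_eq (κ := 1 / (2 * A * max M 1)) (q := p - 4) (by positivity)
    (by linarith)
  refine ⟨2 * r ^ (p - 2) + 1, by positivity, fun u hu => gradSq_le_of_energy (A := A) (r := r) hp ?_ ?_⟩
  · refine (hΩ.lpPow_le u hr0 hp.le hp4.le).trans ?_
    gcongr
    exact h u
  · have hu' : mass u ≤ max M 1 := hu.trans (le_max_left _ _)
    calc r ^ (p - 4) * (A * mass u) ≤ r ^ (p - 4) * (A * max M 1) := by gcongr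
      _ = 1 / 2 := by rw [hr]; field_simp

theorem IsPolygonalDomain.exists_multiplier_le (hΩ : IsPolygonalDomain Ω) {p : ℝ} (hp : 2 < p)
    (hp4 : p < 4) (M : ℝ) : ∃ C, ∀ u : H1 Ω, 0 < mass u → mass u ≤ M → multiplier p u ≤ C := by
  obtain ⟨A, hA, h⟩ := hΩ.exists_lpPow_four_le
  obtain ⟨r, hr0, hr⟩ := exists_rpow_eq (κ := 1 / (A * max M 1)) (q := p - 4) (by positivity)
    (by linarith)
  refine ⟨r ^ (p - 2) + 1, fun u hu0 hu => ?_⟩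
  have hr1 : r ^ (p - 4) * (A * mass u) ≤ 1 := by
    have hu' : mass u ≤ max M 1 := hu.trans (le_max_left _ _)
    calc r ^ (p - 4) * (A * mass u) ≤ r ^ (p - 4) * (A * max M 1) := by gcongr
      _ = 1 := by rw [hr]; field_simp
  refine (multiplier_le (A := A) (r := r) hu0 ?_ hr1).trans (by linarith)
  refine (hΩ.lpPow_le u hr0 hp.le hp4.le).trans ?_
  gcongr
  exact h u

/-- Multipliers are small for small masses. -/
theorem IsPolygonalDomain.exists_multiplier_lt (hΩ : IsPolygonalDomain Ω) {p lam : ℝ} (hp : 2 < p)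
    (hp4 : p < 4) (hlam : 0 < lam) :
    ∃ m, 0 < m ∧ ∀ u : H1 Ω, 0 < mass u → mass u ≤ m → multiplier p u < lam := by
  obtain ⟨A, hA, h⟩ := hΩ.exists_lpPow_four_le
  -- Each of the two terms in the bound on the multiplier is made at most `lam / 3`: the first by
  -- `r`, the second by the mass.
  obtain ⟨r, hr0, hr⟩ := exists_rpow_eq (κ := lam / 3) (q := p - 2) (by positivity) (by linarith)
  have hr4 : 0 < r ^ (p - 4) := by positivity
  refine ⟨min 1 (lam / 3) / (r ^ (p - 4) * A), by positivity, fun u hu0 hu => ?_⟩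
  have hr1 : r ^ (p - 4) * (A * mass u) ≤ min 1 (lam / 3) := by
    rw [le_div_iff₀ (by positivity)] at hu
    linarith
  have := multiplier_le (A := A) (r := r) (p := p) hu0 (by
    refine (hΩ.lpPow_le u hr0 hp.le hp4.le).trans ?_
    gcongr
    exact h u) (hr1.trans (min_le_left _ _))
  have h3 := hr1.trans (min_le_right _ _)
  linarith

/-! ### Existence of energy ground states and continuity of the multiplier -/

/-- Almost minimizers of the energy converge to energy ground states, with their multipliers. -/
theorem IsPolygonalDomain.exists_groundState_of_almost_minimizing (hΩ : IsPolygonalDomain Ω)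
    {p μ : ℝ} (hp : 2 < p) (hp4 : p < 4) (hμ : 0 < μ) {u : ℕ → H1 Ω}
    (hm : Tendsto (fun n => mass (u n)) atTop (𝓝 μ))
    (hmin : ∀ v : H1 Ω, mass v = μ → ∀ ε > 0, ∀ᶠ n in atTop, energy p (u n) ≤ energy p v + ε) :
    ∃ w ∈ energyGroundStates Ω p μ, ∃ φ : ℕ → ℕ, StrictMono φ ∧
      Tendsto (fun n => multiplier p (u (φ n))) atTop (𝓝 (multiplier p w)) := by
  obtain ⟨v₀, hv₀⟩ : ∃ v : H1 Ω, mass v = μ := by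
    have hV := hΩ.volume_real_pos
    obtain ⟨w, -, hw, -⟩ := hΩ.exists_const
    exact ⟨H1.smul (Real.sqrt (μ / volume.real Ω)) w, by
      rw [H1.mass_smul, hw, Real.sq_sqrt (by positivity)]; field_simp⟩
  obtain ⟨C, hC0, hC⟩ := hΩ.exists_gradSq_le hp hp4 (μ + 1)
  have hev : ∀ᶠ n in atTop, mass (u n) ≤ μ + 1 ∧
      gradSq (u n) ≤ 4 * (energy p v₀ + 1) + C * (μ + 1) := by
    filter_upwards [hm.eventually (gt_mem_nhds (show μ < μ + 1 by linarith)),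
      hmin v₀ hv₀ 1 one_pos] with n h1 h2
    refine ⟨h1.le, (hC _ h1.le).trans ?_⟩
    gcongr
  obtain ⟨N, hN⟩ := eventually_atTop.1 hev
  obtain ⟨w, φ, ℓ, hφ, hwm, hwg, hℓ, hwp⟩ := hΩ.exists_subseq (u := fun n => u (n + N))
    (M := max (μ + 1) (4 * (energy p v₀ + 1) + C * (μ + 1)))
    (fun n => (hN (n + N) (by omega)).1.trans (le_max_left _ _))
    (fun n => (hN (n + N) (by omega)).2.trans (le_max_right _ _))
  have hφN : StrictMono fun n => φ n + N := fun a b hab => Nat.add_lt_add_right (hφ hab) N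
  have hmφ := hm.comp hφN.tendsto_atTop
  have hwμ : mass w = μ := tendsto_nhds_unique hwm hmφ
  have hlp := hwp (fun _ => p) p (fun _ => ⟨hp.le, hp4.le⟩) tendsto_const_nhds
  have hE : Tendsto (fun n => energy p (u (φ n + N))) atTop
      (𝓝 (1 / 2 * ℓ - 1 / p * lpPow p w)) :=
    (hwg.const_mul _).sub (hlp.const_mul _)
  have hle : ∀ v : H1 Ω, mass v = μ → 1 / 2 * ℓ - 1 / p * lpPow p w ≤ energy p v := fun v hv =>
    le_of_forall_pos_le_add fun ε hε =>
      le_of_tendsto hE (hφN.tendsto_atTop.eventually (hmin v hv ε hε))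
  have hgs : w ∈ energyGroundStates Ω p μ := mem_energyGroundStates_iff.2 ⟨hwμ, fun v hv => by
    have := hle v hv
    rw [energy]
    linarith⟩
  -- Minimality rules out a loss of gradient in the limit, hence the multipliers converge too.
  have hℓ' : gradSq w = ℓ := by
    have := hle w hwμ
    rw [energy] at this
    linarith
  refine ⟨w, hgs, fun n => φ n + N, hφN, ?_⟩
  rw [multiplier, hℓ']
  exact (hlp.sub hwg).div hwm (by rw [hwμ]; exact hμ.ne')

theorem IsPolygonalDomain.energyGroundStates_nonempty (hΩ : IsPolygonalDomain Ω)
    {p μ : ℝ} (hp : 2 < p) (hp4 : p < 4) (hμ : 0 < μ) : (energyGroundStates Ω p μ).Nonempty := by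
  obtain ⟨C, hC0, hC⟩ := hΩ.exists_gradSq_le hp hp4 μ
  have hne : (energy p '' massSphere Ω μ).Nonempty := by
    have hV := hΩ.volume_real_pos
    obtain ⟨w, -, hw, -⟩ := hΩ.exists_const
    exact ⟨_, H1.smul (Real.sqrt (μ / volume.real Ω)) w, by
      change mass _ = μ
      rw [H1.mass_smul, hw, Real.sq_sqrt (by positivity)]; field_simp, rfl⟩
  have hbdd : BddBelow (energy p '' massSphere Ω μ) := by
    refine ⟨-(C * μ) / 4, ?_⟩
    rintro _ ⟨u, hu, rfl⟩
    have hu : mass u = μ := hu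
    have := hC u hu.le
    have := gradSq_nonneg u
    rw [hu] at *
    linarith
  obtain ⟨x, -, hx, hxS⟩ := exists_seq_tendsto_sInf hne hbdd
  choose u hu hux using hxS
  obtain ⟨w, hw, -⟩ := hΩ.exists_groundState_of_almost_minimizing hp hp4 hμ (u := u)
    (by
      have : ∀ n, mass (u n) = μ := hu
      simp only [this]
      exact tendsto_const_nhds)
    (fun v hv ε hε => by
      have h1 : sInf (energy p '' massSphere Ω μ) < energy p v + ε :=
        lt_of_le_of_lt (csInf_le hbdd ⟨v, hv, rfl⟩) (by linarith)
      filter_upwards [hx.eventually (gt_mem_nhds h1)] with n hn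
      rw [hux n]
      exact hn.le)
  exact ⟨w, hw⟩

/-- Limits of energy ground states are energy ground states. -/
theorem IsPolygonalDomain.exists_groundState_limit (hΩ : IsPolygonalDomain Ω)
    {p μ : ℝ} (hp : 2 < p) (hp4 : p < 4) (hμ : 0 < μ) {x : ℕ → ℝ} (hx0 : ∀ n, 0 < x n)
    (hx : Tendsto x atTop (𝓝 μ)) {u : ℕ → H1 Ω} (hu : ∀ n, u n ∈ energyGroundStates Ω p (x n)) :
    ∃ w ∈ energyGroundStates Ω p μ, ∃ φ : ℕ → ℕ, StrictMono φ ∧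
      Tendsto (fun n => multiplier p (u (φ n))) atTop (𝓝 (multiplier p w)) := by
  refine hΩ.exists_groundState_of_almost_minimizing hp hp4 hμ ?_ fun v hv ε hε => ?_
  · simpa only [(mem_energyGroundStates_iff.1 (hu _)).1] using hx
  -- A competitor of mass `μ` is rescaled to mass `x n`; the scaling factor tends to one, so its
  -- energy changes little.
  · have ht : Tendsto (fun n => Real.sqrt (x n / μ)) atTop (𝓝 1) := by
      have := (hx.div_const μ).sqrt
      rwa [div_self hμ.ne', Real.sqrt_one] at this
    have hE : Tendsto (fun n => energy p (H1.smul (Real.sqrt (x n / μ)) v)) atTop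
        (𝓝 (energy p v)) := by
      have h1 : Tendsto (fun n => 1 / 2 * (Real.sqrt (x n / μ) ^ 2 * gradSq v) -
          1 / p * (Real.sqrt (x n / μ) ^ p * lpPow p v)) atTop
          (𝓝 (1 / 2 * ((1 : ℝ) ^ 2 * gradSq v) - 1 / p * ((1 : ℝ) ^ p * lpPow p v))) :=
        (((ht.pow 2).mul_const _).const_mul _).sub
          (((ht.rpow_const (Or.inl one_ne_zero)).mul_const _).const_mul _)
      simp only [one_pow, Real.one_rpow, one_mul] at h1
      refine (h1.congr fun n => ?_)
      rw [energy_smul (Real.sqrt_nonneg _)]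
    filter_upwards [hE.eventually (gt_mem_nhds (show energy p v < energy p v + ε by linarith))]
      with n hn
    refine ((mem_energyGroundStates_iff.1 (hu n)).2 _ ?_).trans hn.le
    rw [H1.mass_smul, hv, Real.sq_sqrt (div_nonneg (hx0 n).le hμ.le)]
    field_simp

/-- If no mass has two multipliers, all ground states of a given mass have the same multiplier. -/
theorem IsPolygonalDomain.multiplier_eq_of_nonuniqueMasses_eq_empty (hΩ : IsPolygonalDomain Ω)
    {p μ : ℝ} (hp : 2 < p) (hp4 : p < 4) (hW : nonuniqueMasses Ω p = ∅) (hμ : 0 < μ) {u : H1 Ω}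
    (hu : u ∈ energyGroundStates Ω p μ) : multiplier p u = multiplierSup Ω p μ := by
  have heq : multiplierInf Ω p μ = multiplierSup Ω p μ := by
    by_contra h
    exact (eq_empty_iff_forall_notMem.1 hW μ) ⟨hμ, h⟩
  -- The real `sInf` and `sSup` bound the set only when it is bounded, so both bounds on the
  -- multipliers are required.
  obtain ⟨C, hC⟩ := hΩ.exists_multiplier_le hp hp4 μ
  refine le_antisymm (le_csSup ⟨C, ?_⟩ ⟨u, hu, rfl⟩) (heq ▸ csInf_le ⟨0, ?_⟩ ⟨u, hu, rfl⟩)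
  · rintro _ ⟨v, hv, rfl⟩
    have hm := (mem_energyGroundStates_iff.1 hv).1
    exact hC v (hm ▸ hμ) hm.le
  · rintro _ ⟨v, hv, rfl⟩
    exact (hΩ.multiplier_pos hp hμ hv).le

/-- Any sequence of ground states with masses tending to `μ` has multipliers that accumulate at that
of some ground state of mass `μ`, and this value is unique by assumption. -/
theorem IsPolygonalDomain.continuousAt_multiplierSup (hΩ : IsPolygonalDomain Ω)
    {p μ : ℝ} (hp : 2 < p) (hp4 : p < 4) (hW : nonuniqueMasses Ω p = ∅) (hμ : 0 < μ) :
    ContinuousAt (multiplierSup Ω p) μ := by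
  refine tendsto_of_subseq_tendsto fun x hx => ?_
  obtain ⟨N, hN⟩ := eventually_atTop.1 (hx.eventually (lt_mem_nhds hμ))
  have hpos : ∀ n, 0 < x (n + N) := fun n => hN _ (by omega)
  choose u hu using fun n => hΩ.energyGroundStates_nonempty hp hp4 (hpos n)
  obtain ⟨w, hw, φ, hφ, hlim⟩ := hΩ.exists_groundState_limit hp hp4 hμ hpos
    (hx.comp (tendsto_add_atTop_nat N)) hu
  refine ⟨fun n => φ n + N, ?_⟩
  rw [hΩ.multiplier_eq_of_nonuniqueMasses_eq_empty hp hp4 hW hμ hw] at hlim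
  refine hlim.congr fun n => ?_
  exact hΩ.multiplier_eq_of_nonuniqueMasses_eq_empty hp hp4 hW (hpos _) (hu _)

/-- If no mass has two multipliers, some action ground states have increasing masses. -/
theorem IsPolygonalDomain.exists_mass_lt_mass (hΩ : IsPolygonalDomain Ω) {p lam₁ lam₂ : ℝ}
    (hp : 2 < p) (hp4 : p < 4) (hW : nonuniqueMasses Ω p = ∅) (h₁ : 0 < lam₁) (h₂ : lam₁ < lam₂) :
    ∃ u ∈ actionGroundStates Ω p lam₁, ∃ v ∈ actionGroundStates Ω p lam₂, mass u < mass v := by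
  have hV := hΩ.volume_real_pos
  have hne : ∀ μ, 0 < μ → ∃ u ∈ energyGroundStates Ω p μ, multiplier p u = multiplierSup Ω p μ :=
    fun μ hμ => by
      obtain ⟨u, hu⟩ := hΩ.energyGroundStates_nonempty hp hp4 hμ
      exact ⟨u, hu, hΩ.multiplier_eq_of_nonuniqueMasses_eq_empty hp hp4 hW hμ hu⟩
  have hcont : ContinuousOn (multiplierSup Ω p) (Ioi 0) := fun μ hμ =>
    (hΩ.continuousAt_multiplierSup hp hp4 hW hμ).continuousWithinAt
  obtain ⟨m, hm0, hm⟩ := hΩ.exists_multiplier_lt hp hp4 h₁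
  have hsmall : ∀ μ, 0 < μ → μ ≤ m → multiplierSup Ω p μ < lam₁ := fun μ hμ hμm => by
    obtain ⟨u, hu, h⟩ := hne μ hμ
    have hmass := (mem_energyGroundStates_iff.1 hu).1
    rw [← h]
    exact hm u (hmass ▸ hμ) (hmass ▸ hμm)
  have hlam₂ : 0 < lam₂ := h₁.trans h₂
  have hp0 : 0 < p := by linarith
  -- The constant `c` is chosen so that its lower bound `(2/p) c^(p-2)` equals `lam₂`.
  obtain ⟨c, hc0, hc⟩ := exists_rpow_eq (κ := p / 2 * lam₂) (q := p - 2) (by positivity)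
    (by linarith)
  set μ₀ := c ^ 2 * volume.real Ω
  have hμ₀ : 0 < μ₀ := by positivity
  have hlarge : lam₂ ≤ multiplierSup Ω p μ₀ := by
    obtain ⟨u, hu, h⟩ := hne μ₀ hμ₀
    rw [← h]
    refine le_trans (le_of_eq ?_) (hΩ.multiplier_ge hp hc0 hu)
    rw [hc]
    field_simp
  have hsub : ∀ {a b : ℝ}, 0 < a → 0 < b → uIcc a b ⊆ Ioi 0 := fun {a b} ha hb x hx =>
    (lt_min ha hb).trans_le hx.1
  obtain ⟨β, hβ, hβ2⟩ := intermediate_value_uIcc (hcont.mono (hsub hm0 hμ₀))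
    (show lam₂ ∈ uIcc (multiplierSup Ω p m) (multiplierSup Ω p μ₀) from
      Icc_subset_uIcc ⟨((hsmall m hm0 le_rfl).trans h₂).le, hlarge⟩)
  have hβ0 : 0 < β := hsub hm0 hμ₀ hβ
  have hmin0 : 0 < min m β := lt_min hm0 hβ0
  have hs' := hsmall _ hmin0 (min_le_left _ _)
  -- The search for `lam₁` is confined to masses at most `β`, starting from a mass small enough for
  -- the value to be below `lam₁`; this gives the order `α < β` although `Λ` need not be monotone.
  obtain ⟨α, hα, hα1⟩ := intermediate_value_Icc (min_le_right m β)
    (hcont.mono fun x hx => hmin0.trans_le hx.1)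
    (show lam₁ ∈ Icc (multiplierSup Ω p (min m β)) (multiplierSup Ω p β) from
      ⟨hs'.le, hβ2 ▸ h₂.le⟩)
  have hα0 : 0 < α := hmin0.trans_le hα.1
  have hαβ : α < β := lt_of_le_of_ne hα.2 fun h => by
    rw [h, hβ2] at hα1
    exact h₂.ne' hα1
  obtain ⟨u, hu, hul⟩ := hne α hα0
  obtain ⟨v, hv, hvl⟩ := hne β hβ0
  refine ⟨u, ?_, v, ?_, ?_⟩
  · have := mem_actionGroundStates_of_mem_energyGroundStates hp hα0 hu
    rwa [hul, hα1] at this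
  · have := mem_actionGroundStates_of_mem_energyGroundStates hp hβ0 hv
    rwa [hvl, hβ2] at this
  · rwa [(mem_energyGroundStates_iff.1 hu).1, (mem_energyGroundStates_iff.1 hv).1]

/-! ### The limit `p → 4` for action ground states -/

theorem action_eq_of_mem_nehari {p lam : ℝ} {u : H1 Ω} (hu : u ∈ nehari Ω p lam) :
    action p lam u = (1 / 2 - 1 / p) * (gradSq u + lam * mass u) := by
  have h : gradSq u + lam * mass u = lpPow p u := hu.2
  rw [action, ← h]
  ring

theorem action_smul {c : ℝ} (hc : 0 ≤ c) (p lam : ℝ) (u : H1 Ω) :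
    action p lam (H1.smul c u) =
      1 / 2 * (c ^ 2 * (gradSq u + lam * mass u)) - 1 / p * (c ^ p * lpPow p u) := by
  rw [action, H1.gradSq_smul, H1.mass_smul, H1.lpPow_smul hc]
  ring

theorem smul_mem_nehari {t p lam : ℝ} {u : H1 Ω} (ht : 0 < t) (hu : 0 < mass u)
    (h : gradSq u + lam * mass u = t ^ (p - 2) * lpPow p u) : H1.smul t u ∈ nehari Ω p lam := by
  refine ⟨toLp_ne_zero_of_mass_pos (by rw [H1.mass_smul]; positivity), ?_⟩
  rw [H1.gradSq_smul, H1.mass_smul, H1.lpPow_smul ht.le]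
  have : t ^ p = t ^ (p - 2) * t ^ 2 := by
    rw [← Real.rpow_natCast, ← Real.rpow_add ht]
    norm_num
  rw [this]
  linear_combination t ^ 2 * h

theorem IsPolygonalDomain.nehari_four_nonempty (hΩ : IsPolygonalDomain Ω) {lam : ℝ}
    (hlam : 0 < lam) : (nehari Ω 4 lam).Nonempty := by
  have hV := hΩ.volume_real_pos
  obtain ⟨w, hw1, hw2, hw3⟩ := hΩ.exists_const
  refine ⟨_, smul_mem_nehari (t := Real.sqrt lam) (u := w) (Real.sqrt_pos.2 hlam) (hw2 ▸ hV) ?_⟩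
  rw [hw1, hw2, hw3, show (4 - 2 : ℝ) = (2 : ℕ) by norm_num, Real.rpow_natCast,
    Real.sq_sqrt hlam.le, zero_add]

/-- The masses on the Nehari manifolds are bounded below, uniformly in `p`. -/
theorem IsPolygonalDomain.exists_le_mass (hΩ : IsPolygonalDomain Ω) {lam : ℝ} (hlam : 0 < lam) :
    ∃ δ, 0 < δ ∧ ∀ p, 3 ≤ p → p ≤ 4 → ∀ u ∈ nehari Ω p lam, δ ≤ mass u := by
  obtain ⟨A, hA, h4⟩ := hΩ.exists_lpPow_four_le
  -- For `3 ≤ p ≤ 4` this gives `r^(p-2) ≤ lam / 2` and `r^(p-4) ≤ r⁻¹`. Half of `Q` is then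
  -- absorbed, and dividing the rest by `Q` bounds the mass below uniformly in `p`.
  set r := min 1 (lam / 2)
  have hr : 0 < r := by positivity
  have hr1 : r ≤ 1 := min_le_left _ _
  set D := r⁻¹ * A * (1 / lam + 1)
  have hD : 0 < D := by positivity
  refine ⟨1 / (2 * D), by positivity, fun p hp3 hp4 u hu => ?_⟩
  have hm := mass_pos_of_ne_zero hu.1
  have hg := gradSq_nonneg u
  have hN : gradSq u + lam * mass u = lpPow p u := hu.2
  set Q := gradSq u + lam * mass u
  have hQ : 0 < Q := by positivity
  have e1 : r ^ (p - 2) ≤ lam / 2 := by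
    have := Real.rpow_le_rpow_of_exponent_ge hr hr1 (show 1 ≤ p - 2 by linarith)
    rw [Real.rpow_one] at this
    exact this.trans (min_le_right _ _)
  have e2 : r ^ (p - 4) ≤ r⁻¹ := by
    rw [← Real.rpow_neg_one]
    exact Real.rpow_le_rpow_of_exponent_ge hr hr1 (by linarith)
  have e3 : mass u + gradSq u ≤ (1 / lam + 1) * Q := by
    have h1 : mass u ≤ 1 / lam * Q := by
      rw [one_div, ← div_eq_inv_mul, le_div_iff₀ hlam]
      simp only [Q]
      linarith
    have h2 : gradSq u ≤ Q := by
      simp only [Q]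
      linarith [mul_pos hlam hm]
    linarith
  have e4 : lpPow 4 u ≤ A * (mass u * ((1 / lam + 1) * Q)) := (h4 u).trans (by gcongr)
  have e5 := hΩ.lpPow_le u hr (by linarith : (2 : ℝ) ≤ p) hp4
  have e6 : r ^ (p - 2) * mass u ≤ lam / 2 * mass u := by gcongr
  have e7 : r ^ (p - 4) * lpPow 4 u ≤ r⁻¹ * (A * (mass u * ((1 / lam + 1) * Q))) := by
    have := lpPow_nonneg 4 u
    gcongr
  have e8 : r⁻¹ * (A * (mass u * ((1 / lam + 1) * Q))) = D * mass u * Q := by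
    simp only [D]
    ring
  have e9 : lam * mass u ≤ Q := by
    simp only [Q]
    linarith
  have e10 : 1 / 2 * Q ≤ D * mass u * Q := by linarith
  have e11 := le_of_mul_le_mul_right e10 hQ
  rw [div_le_iff₀ (by positivity)]
  linarith

/-- Projecting a fixed function to the Nehari manifolds gives almost the same action. -/
theorem IsPolygonalDomain.eventually_action_le (hΩ : IsPolygonalDomain Ω) {lam : ℝ}
    (hlam : 0 < lam) {p : ℕ → ℝ} (hp : ∀ n, p n ∈ Ioo 3 4) (hp4 : Tendsto p atTop (𝓝 4))
    {u : ℕ → H1 Ω} (hu : ∀ n, u n ∈ actionGroundStates Ω (p n) lam) {v : H1 Ω}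
    (hv : v ∈ nehari Ω 4 lam) {ε : ℝ} (hε : 0 < ε) :
    ∀ᶠ n in atTop, action (p n) lam (u n) ≤ action 4 lam v + ε := by
  have hvm := mass_pos_of_ne_zero hv.1
  have hg := gradSq_nonneg v
  have hN : gradSq v + lam * mass v = lpPow 4 v := hv.2
  set Q := gradSq v + lam * mass v
  have hQ : 0 < Q := by positivity
  have hB : Tendsto (fun n => lpPow (p n) v) atTop (𝓝 Q) := by
    rw [hN]
    exact hΩ.tendsto_lpPow_exponent v
      (fun n => ⟨by linarith [(hp n).1], (hp n).2.le⟩) hp4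
  -- This is the factor that projects `v` to the Nehari manifold for `p n`; it tends to one since
  -- `v` already lies on the one for `4`.
  have ht : Tendsto (fun n => (Q / lpPow (p n) v) ^ (p n - 2)⁻¹) atTop (𝓝 1) := by
    have h1 : Tendsto (fun n => Q / lpPow (p n) v) atTop (𝓝 1) := by
      have := (tendsto_const_nhds (x := Q)).div hB hQ.ne'
      rwa [div_self hQ.ne'] at this
    have h2 : Tendsto (fun n => (p n - 2)⁻¹) atTop (𝓝 (4 - 2)⁻¹) :=
      (hp4.sub_const 2).inv₀ (by norm_num)
    have := h1.rpow h2 (Or.inl one_ne_zero)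
    rwa [Real.one_rpow] at this
  have hlim : Tendsto (fun n => 1 / 2 * (((Q / lpPow (p n) v) ^ (p n - 2)⁻¹) ^ 2 * Q) -
      1 / p n * (((Q / lpPow (p n) v) ^ (p n - 2)⁻¹) ^ p n * lpPow (p n) v)) atTop
      (𝓝 (1 / 2 * ((1 : ℝ) ^ 2 * Q) - 1 / 4 * ((1 : ℝ) ^ (4 : ℝ) * Q))) := by
    refine (((ht.pow 2).mul_const _).const_mul _).sub (Tendsto.mul ?_ (Tendsto.mul ?_ hB))
    · exact tendsto_const_nhds.div hp4 (by norm_num)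
    · exact ht.rpow hp4 (Or.inl one_ne_zero)
  have hval : 1 / 2 * ((1 : ℝ) ^ 2 * Q) - 1 / 4 * ((1 : ℝ) ^ (4 : ℝ) * Q) = action 4 lam v := by
    rw [action_eq_of_mem_nehari hv, Real.one_rpow]
    ring
  rw [hval] at hlim
  filter_upwards [hlim.eventually (gt_mem_nhds (show action 4 lam v < action 4 lam v + ε by linarith)),
    hB.eventually (lt_mem_nhds hQ)] with n hn hBn
  have hpos : 0 < (Q / lpPow (p n) v) ^ (p n - 2)⁻¹ := by positivity
  have hmem : H1.smul ((Q / lpPow (p n) v) ^ (p n - 2)⁻¹) v ∈ nehari Ω (p n) lam := by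
    refine smul_mem_nehari hpos hvm ?_
    rw [Real.rpow_inv_rpow (by positivity) (by linarith [(hp n).1])]
    field_simp
    rfl
  refine ((mem_actionGroundStates_iff.1 (hu n)).2 _ hmem).trans ?_
  rw [action_smul hpos.le]
  exact hn.le

/-- As `p → 4⁻`, action ground states converge to action ground states. -/
theorem IsPolygonalDomain.exists_actionGroundState_limit (hΩ : IsPolygonalDomain Ω) {lam : ℝ}
    (hlam : 0 < lam) {p : ℕ → ℝ} (hp : ∀ n, p n ∈ Ioo 3 4) (hp4 : Tendsto p atTop (𝓝 4))
    {u : ℕ → H1 Ω} (hu : ∀ n, u n ∈ actionGroundStates Ω (p n) lam) :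
    ∃ w ∈ actionGroundStates Ω 4 lam, ∃ φ : ℕ → ℕ, StrictMono φ ∧
      Tendsto (fun n => mass (u (φ n))) atTop (𝓝 (mass w)) := by
  obtain ⟨v₀, hv₀⟩ := hΩ.nehari_four_nonempty hlam
  obtain ⟨δ, hδ, hδm⟩ := hΩ.exists_le_mass hlam
  have hun : ∀ n, u n ∈ nehari Ω (p n) lam := fun n => (mem_actionGroundStates_iff.1 (hu n)).1
  obtain ⟨N, hN⟩ := eventually_atTop.1 (hΩ.eventually_action_le hlam hp hp4 hu hv₀ one_pos)
  -- On the Nehari manifold the action is `(1/2 - 1/p) Q`, and `1/2 - 1/p ≥ 1/6` for `p ≥ 3`.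
  set M := 6 * (action 4 lam v₀ + 1)
  have hQ : ∀ n, N ≤ n → gradSq (u n) + lam * mass (u n) ≤ M := fun n hn => by
    have h1 := hN n hn
    rw [action_eq_of_mem_nehari (hun n)] at h1
    have h2 : (1 / 6 : ℝ) ≤ 1 / 2 - 1 / p n := by
      have : 1 / p n ≤ 1 / 3 := one_div_le_one_div_of_le (by norm_num) (hp n).1.le
      linarith
    have h3 := mul_le_mul_of_nonneg_right h2
      (add_nonneg (gradSq_nonneg (u n)) (mul_nonneg hlam.le (mass_nonneg (u n))))
    simp only [M]
    linarith
  obtain ⟨w, φ, ℓ, hφ, hwm, hwg, hℓ, hwp⟩ := hΩ.exists_subseq (u := fun n => u (n + N))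
    (M := max (M / lam) M)
    (fun n => by
      have := hQ (n + N) (by omega)
      have := gradSq_nonneg (u (n + N))
      refine le_trans ?_ (le_max_left _ _)
      rw [le_div_iff₀ hlam]
      linarith)
    (fun n => by
      have := hQ (n + N) (by omega)
      have := mul_nonneg hlam.le (mass_nonneg (u (n + N)))
      refine le_trans ?_ (le_max_right _ _)
      linarith)
  have hφN : StrictMono fun n => φ n + N := fun a b hab => Nat.add_lt_add_right (hφ hab) N
  have hpφ : Tendsto (fun n => p (φ n + N)) atTop (𝓝 4) := hp4.comp hφN.tendsto_atTop
  have hlp := hwp (fun n => p (φ n + N)) 4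
    (fun n => ⟨by linarith [(hp (φ n + N)).1], (hp (φ n + N)).2.le⟩) hpφ
  -- The uniform lower bound on masses keeps the limit away from zero.
  have hδw : δ ≤ mass w := ge_of_tendsto' hwm fun n =>
    hδm _ (hp _).1.le (hp _).2.le _ (hun (φ n + N))
  have hw0 : 0 < mass w := hδ.trans_le hδw
  have hQlim : Tendsto (fun n => gradSq (u (φ n + N)) + lam * mass (u (φ n + N))) atTop
      (𝓝 (ℓ + lam * mass w)) := hwg.add (hwm.const_mul lam)
  have hB : ℓ + lam * mass w = lpPow 4 w :=
    tendsto_nhds_unique hQlim (hlp.congr fun n => ((hun (φ n + N)).2).symm)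
  set B := lpPow 4 w
  set Q := gradSq w + lam * mass w with hQdef
  have hQ0 : 0 < Q := by
    have := gradSq_nonneg w
    positivity
  have hQB : Q ≤ B := by rw [← hB]; linarith
  have hB0 : 0 < B := hQ0.trans_le hQB
  have hact : Tendsto (fun n => action (p (φ n + N)) lam (u (φ n + N))) atTop (𝓝 (1 / 4 * B)) := by
    have h1 : Tendsto (fun n => (1 / 2 - 1 / p (φ n + N)) *
        (gradSq (u (φ n + N)) + lam * mass (u (φ n + N)))) atTop (𝓝 ((1 / 2 - 1 / 4) * B)) := by
      rw [← hB]
      exact ((tendsto_const_nhds.div hpφ (by norm_num)).const_sub _).mul hQlim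
    have h2 : (1 / 2 - 1 / 4) * B = 1 / 4 * B := by ring
    rw [h2] at h1
    exact h1.congr fun n => (action_eq_of_mem_nehari (hun _)).symm
  have hle : ∀ v ∈ nehari Ω 4 lam, 1 / 4 * B ≤ action 4 lam v := fun v hv =>
    le_of_forall_pos_le_add fun ε hε => le_of_tendsto hact
      (hφN.tendsto_atTop.eventually (hΩ.eventually_action_le hlam hp hp4 hu hv hε))
  -- If gradient were lost, so that `Q < B`, projecting `w` to the Nehari manifold would give the
  -- action `Q² / (4 B)`, below the limiting level `B / 4`.
  have hBQ : B ≤ Q := by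
    have ht0 : 0 < Real.sqrt (Q / B) := Real.sqrt_pos.2 (by positivity)
    have ht2 : Real.sqrt (Q / B) ^ 2 = Q / B := Real.sq_sqrt (by positivity)
    have hmem : H1.smul (Real.sqrt (Q / B)) w ∈ nehari Ω 4 lam := by
      refine smul_mem_nehari ht0 hw0 ?_
      rw [show (4 - 2 : ℝ) = (2 : ℕ) by norm_num, Real.rpow_natCast, ht2]
      change Q = Q / B * B
      field_simp
    have h1 := hle _ hmem
    rw [action_eq_of_mem_nehari hmem, H1.gradSq_smul, H1.mass_smul, ht2] at h1
    have h2 : Q / B * gradSq w + lam * (Q / B * mass w) = Q / B * Q := by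
      rw [hQdef]
      ring
    rw [h2] at h1
    have h3 : B ≤ Q / B * Q := by linarith
    rw [div_mul_eq_mul_div, le_div_iff₀ hB0] at h3
    nlinarith
  have hwN : w ∈ nehari Ω 4 lam := ⟨toLp_ne_zero_of_mass_pos hw0, le_antisymm hQB hBQ⟩
  refine ⟨w, mem_actionGroundStates_iff.2 ⟨hwN, fun v hv => ?_⟩, fun n => φ n + N, hφN, hwm⟩
  rw [action_eq_of_mem_nehari hwN]
  have := hle v hv
  linarith

/-- All ground states share the action `(gradSq + lam * mass) / 4`, which bounds their masses.
Without this bound the real supremum `M_4^+` could be the default value `0`. -/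
theorem bddAbove_mass_actionGroundStates {lam : ℝ} (hlam : 0 < lam) :
    BddAbove (mass '' actionGroundStates Ω 4 lam) := by
  rcases (actionGroundStates Ω 4 lam).eq_empty_or_nonempty with h | ⟨v, hv⟩
  · simp [h]
  · refine ⟨4 * action 4 lam v / lam, ?_⟩
    rintro _ ⟨w, hw, rfl⟩
    have hw' := mem_actionGroundStates_iff.1 hw
    have h1 := hw'.2 v (mem_actionGroundStates_iff.1 hv).1
    rw [action_eq_of_mem_nehari hw'.1] at h1
    have := gradSq_nonneg w
    rw [le_div_iff₀ hlam]
    linarith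

end NLSPolygon

end

/-! ### The contradiction at `p = 4` -/

theorem proposition5p3 (Ω : Set NLSPolygon.Plane) (hΩ : NLSPolygon.IsPolygonalDomain Ω)
    (lam₁ lam₂ : ℝ) (hlam₁ : 0 < lam₁) (hlam : lam₁ < lam₂)
    (hM : NLSPolygon.massSup Ω 4 lam₂ < NLSPolygon.massInf Ω 4 lam₁) :
    ∃ ε : ℝ, 0 < ε ∧ ∀ p : ℝ, p ∈ Set.Ioo (4 - ε) 4 →
      (NLSPolygon.nonuniqueMasses Ω p).Nonempty := by
  open NLSPolygon Filter Topology in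
  by_contra! hcon
  have hlam₂ : 0 < lam₂ := hlam₁.trans hlam
  -- The choice `ε = 1 / (n + 1) ≤ 1` also keeps `p n > 3`, where the estimates uniform in `p` hold.
  choose p hp hW using fun n : ℕ => hcon (1 / ((n : ℝ) + 1)) (by positivity)
  have hpI : ∀ n, p n ∈ Set.Ioo 3 4 := fun n => by
    refine ⟨lt_of_le_of_lt ?_ (hp n).1, (hp n).2⟩
    have : 1 / ((n : ℝ) + 1) ≤ 1 := by
      rw [div_le_one (by positivity)]
      linarith [(Nat.cast_nonneg n : (0 : ℝ) ≤ n)]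
    linarith
  have hp4 : Tendsto p atTop (𝓝 4) := by
    have h1 : Tendsto (fun n : ℕ => (4 : ℝ) - 1 / ((n : ℝ) + 1)) atTop (𝓝 4) := by
      simpa using (tendsto_one_div_add_atTop_nhds_zero_nat (𝕜 := ℝ)).const_sub 4
    exact tendsto_of_tendsto_of_tendsto_of_le_of_le h1 tendsto_const_nhds
      (fun n => (hp n).1.le) fun n => (hp n).2.le
  choose u hu v hv huv using fun n =>
    hΩ.exists_mass_lt_mass (by linarith [(hpI n).1]) (hpI n).2 (hW n) hlam₁ hlam
  obtain ⟨a, ha, φ, hφ, hlima⟩ := hΩ.exists_actionGroundState_limit hlam₁ hpI hp4 hu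
  -- The second extraction runs along the first subsequence, so that the masses at the two
  -- frequencies are compared at the same exponents.
  obtain ⟨b, hb, ψ, hψ, hlimb⟩ := hΩ.exists_actionGroundState_limit hlam₂ (p := fun n => p (φ n))
    (fun n => hpI _) (hp4.comp hφ.tendsto_atTop) (fun n => hv (φ n))
  have hab : mass a ≤ mass b := le_of_tendsto_of_tendsto' (hlima.comp hψ.tendsto_atTop) hlimb
    fun n => (huv (φ (ψ n))).le
  have h1 : massInf Ω 4 lam₁ ≤ mass a := csInf_le ⟨0, by
    rintro _ ⟨w, -, rfl⟩
    exact mass_nonneg w⟩ ⟨a, ha, rfl⟩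
  have h2 : mass b ≤ massSup Ω 4 lam₂ :=
    le_csSup (bddAbove_mass_actionGroundStates hlam₂) ⟨b, hb, rfl⟩
  linarith
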